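/- Let $\Bbbk$ be a field, and write $\otimes=\otimes_\Bbbk$ and $*$ for convolution products. A \emph{dual quasi-bialgebra} $(H,\omega)$ is a coalgebra $H$ with coalgebra maps $m:H\otimes H\to H$ and $u:\Bbbk\to H$, with $1_H=u(1)$ a two-sided unit for $m$, and a convolution invertible map $\omega:H^{\otimes 3}\to\Bbbk$ which is normalized ($\omega(a\otimes b\otimes c)$ is the product of the counits of the other two entries whenever one of $a,b,c$ is $1_H$), satisfies the cocycle condition $(\varepsilon\otimes\omega)*\omega(H\otimes m\otimes H)*(\omega\otimes\varepsilon)=\omega(H\otimes H\otimes m)*\omega(m\otimes H\otimes H)$, and satisfies $[m(H\otimes m)]*(u\omega)=(u\omega)*[m(m\otimes H)]$. Let ${}^H_H\mathcal{YD}$ be the category of left $H$-comodules $(V,\rho)$, $\rho(v)=v_{-1}\otimes v_0$, with a linear map $H\otimes V\to V$, $h\otimes v\mapsto h\rhd v$, such that $1_H\rhd v=v$, $(h_1\rhd v)_{-1}h_2\otimes(h_1\rhd v)_0=h_1v_{-1}\otimes(h_2\rhd v_0)$ and $$(hl)\rhd v=\omega^{-1}(h_1\otimes l_1\otimes v_{-1})\,\omega(h_2\otimes(l_2\rhd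 v_0)_{-1}\otimes l_3)\,\omega^{-1}\big((h_3\rhd(l_2\rhd v_0)_0)_{-1}\otimes h_4\otimes l_4\big)\,(h_3\rhd(l_2\rhd v_0)_0)_0 .$$ It is prebraided monoidal: the unit is $\Bbbk$ with $\rho(1)=1_H\otimes1$, $h\rhd1=\varepsilon(h)$; $V\otimes W$ has coaction $v\otimes w\mapsto v_{-1}w_{-1}\otimes v_0\otimes w_0$ and action $$h\rhd(v\otimes w)=\omega(h_1\otimes v_{-1}\otimes w_{-2})\,\omega^{-1}((h_2\rhd v_0)_{-2}\otimes h_3\otimes w_{-1})\,\omega((h_2\rhd v_0)_{-1}\otimes(h_4\rhd w_0)_{-1}\otimes h_5)\,(h_2\rhd v_0)_0\otimes(h_4\rhd w_0)_0;$$ the associativity constraint is $a((u\otimes v)\otimes w)=\omega^{-1}(u_{-1}\otimes v_{-1}\otimes w_{-1})\,u_0\otimes(v_0\otimes w_0)$, and the prebraiding is $c(v\otimes w)=(v_{-1}\rhd w)\otimes v_0$. For $V\in{}^H_H\mathcal{YD}$ the tensor algebra is $T(V)=\bigoplus_{n\ge0}T^n(V)$ with $T^0(V)=\Bbbk$, $T^1(V)=V$,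 $T^n(V)=V\otimes T^{n-1}(V)$ for $n>1$; its multiplication is given by the constraints: $1_{T(V)}=1_\Bbbk$ is a left unit, a product of $v\in V$ with $y\in T^n(V)$, $n\ge1$, is $v\otimes y$, one has $v\,1=v$, and for $v\in V$, $x\in T^{n}(V)$, $n\ge1$, $(v\otimes x)y=\omega^{-1}(v_{-1}\otimes x_{-1}\otimes y_{-1})\,v_0(x_0y_0)$. Let $((H,\omega),g,\chi)$ be a quasi-Yetter--Drinfeld datum for $q$, i.e. $g\in H$ is grouplike, $\chi\in H^*$, $\chi(1_H)=1$, $q=\chi(g)$, and for all $h,l\in H$ $$\chi(hl)=\omega^{-1}(h_1\otimes l_1\otimes g)\chi(l_2)\omega(h_2\otimes g\otimes l_3)\chi(h_3)\omega^{-1}(g\otimes h_4\otimes l_4),\qquad g\,\chi(h_1)h_2=h_1\chi(h_2)\,g .$$ Let $V=\Bbbk v$ be one-dimensional with $\rho(v)=g\otimes v$ and $h\rhd v=\chi(h)v$. Put $v^{[0]}=1$, $v^{[1]}=v$, $v^{[n]}=v\otimes v^{[n-1]}$ for $n>1$, and $g^0=1_H$, $g^{n+1}=g\,g^n$. Then $V$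 is an object of ${}^H_H\mathcal{YD}$; $T(V)$ is an algebra in ${}^H_H\mathcal{YD}$, the free one on $V$ (every morphism from $V$ to an algebra in ${}^H_H\mathcal{YD}$ extends uniquely to an algebra morphism in ${}^H_H\mathcal{YD}$ from $T(V)$); and there are unique linear maps $\Delta_T:T(V)\to T(V)\otimes T(V)$ and $\varepsilon_T:T(V)\to\Bbbk$ which make $T(V)$ a bialgebra in ${}^H_H\mathcal{YD}$ with $\Delta_T(x)=x\otimes1+1\otimes x$ and $\varepsilon_T(x)=0$ for $x\in V$. The family $(v^{[n]})_{n\in\mathbb N}$ is a basis of $T(V)$, and the structure is as follows. (i) $\rho(v^{[n]})=g^n\otimes v^{[n]}$ and $h\rhd v^{[n]}=\chi_{[n]}(h)v^{[n]}$, where $\chi_{[0]}=\varepsilon$ and, for $n\ge1$, $$\chi_{[n]}=\omega(-\otimes g\otimes g^{n-1})*\chi*\omega^{-1}(g\otimes-\otimes g^{n-1})*\chi_{[n-1]}*\omega(g\otimes g^{n-1}\otimes-).$$ Furthermore, for $n\ge1$ (ordered convolution products, $i$ increasing from left to right), $$\chi_{[n]}=\Big[\prod_{0\le i\le n-1}^{*}\omega(-\otimes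 g\otimes g^{n-1-i})*\chi*\omega^{-1}(g\otimes-\otimes g^{n-1-i})\Big]*\Big[\prod_{0\le i\le n-1}^{*}\omega(g\otimes g^i\otimes-)\Big],$$ and in particular $\chi_{[n]}(g)=q^n\prod_{0\le i\le n-1}\omega(g\otimes g^i\otimes g)$. (ii) $1_{T(V)}=v^{[0]}$, and $v^{[a]}v^{[b]}=\Big[\prod_{0\le i\le a-1}\omega^{-1}(g\otimes g^i\otimes g^b)\Big]v^{[a+b]}$ for all $a,b\in\mathbb N$. (iii) $\varepsilon_T(v^{[n]})=\delta_{n,0}$ and $\Delta_T(v^{[n]})=\sum_{0\le i\le n}\beta(i,n)\,v^{[i]}\otimes v^{[n-i]}$, where $\beta(i,n)=\binom{n}{i}_q\prod_{0\le j\le i-1}\omega(g\otimes g^j\otimes g^{n-i})$ with $\binom{n}{i}_q$ the Gaussian binomial coefficient evaluated at $q$ (empty products are $1$). In particular $\beta(0,n)=1=\beta(n,n)$ for all $n\ge0$. -/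

import Mathlib

open scoped TensorProduct

universe u v

noncomputable section

/-! ## Dual quasi-bialgebras -/

/-- A dual quasi-bialgebra structure on a coalgebra `H` over `k`: a multiplication and a unit that
are coalgebra maps, and a reassociator `ω`, i.e. a convolution invertible normalized `3`-cocycle
`H ⊗ H ⊗ H → k` for which the multiplication is quasi-associative.  `ω⁻¹` is the convolution
inverse; products of functionals are convolution products. -/
structure DualQuasiBialgebra (k : Type u) (H : Type v) [Field k] [AddCommGroup H] [Module k H]
    [Coalgebra k H] where
  /-- The multiplication, a coalgebra map. -/
  mul : H ⊗[k] H →ₗc[k] H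
  /-- The unit, a coalgebra map. -/
  unit : k →ₗc[k] H
  /-- The reassociator, a unit of the convolution algebra. -/
  ω : (WithConv (H ⊗[k] (H ⊗[k] H) →ₗ[k] k))ˣ
  one_mul' : ∀ h : H, mul (unit 1 ⊗ₜ[k] h) = h
  mul_one' : ∀ h : H, mul (h ⊗ₜ[k] unit 1) = h
  /-- `(ε ⊗ ω) * ω(H ⊗ m ⊗ H) * (ω ⊗ ε) = ω(H ⊗ H ⊗ m) * ω(m ⊗ H ⊗ H)`. -/
  cocycle :
    (WithConv.toConv ((TensorProduct.lid k k).toLinearMap ∘ₗ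
        TensorProduct.map Coalgebra.counit ω.val.ofConv) :
      WithConv (H ⊗[k] (H ⊗[k] (H ⊗[k] H)) →ₗ[k] k)) *
    WithConv.toConv (ω.val.ofConv ∘ₗ LinearMap.lTensor H
        (LinearMap.rTensor H mul.toLinearMap ∘ₗ (TensorProduct.assoc k H H H).symm.toLinearMap)) *
    WithConv.toConv (ω.val.ofConv ∘ₗ LinearMap.lTensor H (LinearMap.lTensor H
        ((TensorProduct.rid k H).toLinearMap ∘ₗ LinearMap.lTensor H Coalgebra.counit))) =
    WithConv.toConv (ω.val.ofConv ∘ₗ LinearMap.lTensor H (LinearMap.lTensor H mul.toLinearMap)) *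
    WithConv.toConv (ω.val.ofConv ∘ₗ LinearMap.rTensor (H ⊗[k] H) mul.toLinearMap ∘ₗ
        (TensorProduct.assoc k H H (H ⊗[k] H)).symm.toLinearMap)
  /-- Normalization.  For a cocycle the three normalization conditions are equivalent. -/
  normal_left : ∀ h h' : H, ω.val.ofConv (unit 1 ⊗ₜ[k] (h ⊗ₜ[k] h')) =
    Coalgebra.counit (R := k) h * Coalgebra.counit (R := k) h'
  normal_mid : ∀ h h' : H, ω.val.ofConv (h ⊗ₜ[k] (unit 1 ⊗ₜ[k] h')) =
    Coalgebra.counit (R := k) h * Coalgebra.counit (R := k) h'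
  normal_right : ∀ h h' : H, ω.val.ofConv (h ⊗ₜ[k] (h' ⊗ₜ[k] unit 1)) =
    Coalgebra.counit (R := k) h * Coalgebra.counit (R := k) h'
  /-- `[m (H ⊗ m)] * (u ω) = (u ω) * [m (m ⊗ H)]` in `Hom(H ⊗ H ⊗ H, H)`, where the convolution
  product of `F` and `G` is `m ∘ (F ⊗ G) ∘ Δ`. -/
  quasi_assoc :
    mul.toLinearMap ∘ₗ
        TensorProduct.map
          (mul.toLinearMap ∘ₗ LinearMap.lTensor H mul.toLinearMap)
          (unit.toLinearMap ∘ₗ ω.val.ofConv) ∘ₗ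
        Coalgebra.comul (R := k) (A := H ⊗[k] (H ⊗[k] H)) =
      mul.toLinearMap ∘ₗ
        TensorProduct.map
          (unit.toLinearMap ∘ₗ ω.val.ofConv)
          (mul.toLinearMap ∘ₗ LinearMap.rTensor H mul.toLinearMap ∘ₗ
            (TensorProduct.assoc k H H H).symm.toLinearMap) ∘ₗ
        Coalgebra.comul (R := k) (A := H ⊗[k] (H ⊗[k] H))

namespace DualQuasiBialgebra

variable {k : Type u} {H : Type v} [Field k] [AddCommGroup H] [Module k H] [Coalgebra k H]

/-- The unit element `1_H`. -/
def one (D : DualQuasiBialgebra k H) : H := D.unit 1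

/-- Powers `g ^ n` for the multiplication of `H`, by `g ^ (n + 1) = g (g ^ n)`; for grouplike `g`
the bracketing is immaterial. -/
def pow (D : DualQuasiBialgebra k H) (g : H) : ℕ → H
  | 0 => D.one
  | n + 1 => D.mul (g ⊗ₜ[k] D.pow g n)

/-- The value `ω(a ⊗ b ⊗ c)`. -/
def om (D : DualQuasiBialgebra k H) (a b c : H) : k :=
  D.ω.val.ofConv (a ⊗ₜ[k] (b ⊗ₜ[k] c))

/-- The value `ω⁻¹(a ⊗ b ⊗ c)` of the convolution inverse of `ω`. -/
def omInv (D : DualQuasiBialgebra k H) (a b c : H) : k :=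
  (D.ω⁻¹).val.ofConv (a ⊗ₜ[k] (b ⊗ₜ[k] c))

end DualQuasiBialgebra

/-! ## Filling some of the arguments of a trilinear functional -/

section Slots

variable {k : Type u} {H : Type v} [Field k] [AddCommGroup H] [Module k H]

/-- `f(- ⊗ a ⊗ b)`. -/
def slot₁ (f : WithConv (H ⊗[k] (H ⊗[k] H) →ₗ[k] k)) (a b : H) : WithConv (H →ₗ[k] k) :=
  WithConv.toConv (f.ofConv ∘ₗ (TensorProduct.mk k H (H ⊗[k] H)).flip (a ⊗ₜ[k] b))

/-- `f(a ⊗ - ⊗ b)`. -/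
def slot₂ (f : WithConv (H ⊗[k] (H ⊗[k] H) →ₗ[k] k)) (a b : H) : WithConv (H →ₗ[k] k) :=
  WithConv.toConv (f.ofConv ∘ₗ TensorProduct.mk k H (H ⊗[k] H) a ∘ₗ
    (TensorProduct.mk k H H).flip b)

/-- `f(a ⊗ b ⊗ -)`. -/
def slot₃ (f : WithConv (H ⊗[k] (H ⊗[k] H) →ₗ[k] k)) (a b : H) : WithConv (H →ₗ[k] k) :=
  WithConv.toConv (f.ofConv ∘ₗ TensorProduct.mk k H (H ⊗[k] H) a ∘ₗ TensorProduct.mk k H H b)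

/-- `h ⊗ l ↦ f(h ⊗ l ⊗ a)`. -/
def slot₁₂ (f : WithConv (H ⊗[k] (H ⊗[k] H) →ₗ[k] k)) (a : H) : WithConv (H ⊗[k] H →ₗ[k] k) :=
  WithConv.toConv (f.ofConv ∘ₗ LinearMap.lTensor H ((TensorProduct.mk k H H).flip a))

/-- `h ⊗ l ↦ f(h ⊗ a ⊗ l)`. -/
def slot₁₃ (f : WithConv (H ⊗[k] (H ⊗[k] H) →ₗ[k] k)) (a : H) : WithConv (H ⊗[k] H →ₗ[k] k) :=
  WithConv.toConv (f.ofConv ∘ₗ LinearMap.lTensor H (TensorProduct.mk k H H a))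

/-- `h ⊗ l ↦ f(a ⊗ h ⊗ l)`. -/
def slot₂₃ (f : WithConv (H ⊗[k] (H ⊗[k] H) →ₗ[k] k)) (a : H) : WithConv (H ⊗[k] H →ₗ[k] k) :=
  WithConv.toConv (f.ofConv ∘ₗ TensorProduct.mk k H (H ⊗[k] H) a)

end Slots

/-! ## Quasi-Yetter-Drinfeld data -/

/-- `((H, ω), g, χ)` is a quasi-Yetter-Drinfeld datum. -/
structure IsQuasiYDDatum {k : Type u} {H : Type v} [Field k] [AddCommGroup H] [Module k H]
    [Coalgebra k H] (D : DualQuasiBialgebra k H) (g : H) (χ : H →ₗ[k] k) : Prop where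
  grouplike : IsGroupLikeElem k g
  unitary : χ D.one = 1
  /-- `χ(hl) = ω⁻¹(h₁ ⊗ l₁ ⊗ g) χ(l₂) ω(h₂ ⊗ g ⊗ l₃) χ(h₃) ω⁻¹(g ⊗ h₄ ⊗ l₄)`, as an identity in
  the convolution algebra of functionals on `H ⊗ H`. -/
  chi_mul :
    (WithConv.toConv (χ ∘ₗ D.mul.toLinearMap) : WithConv (H ⊗[k] H →ₗ[k] k)) =
      slot₁₂ (D.ω⁻¹).val g *
      WithConv.toConv ((TensorProduct.lid k k).toLinearMap ∘ₗ
        TensorProduct.map Coalgebra.counit χ) *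
      slot₁₃ D.ω.val g *
      WithConv.toConv ((TensorProduct.lid k k).toLinearMap ∘ₗ
        TensorProduct.map χ Coalgebra.counit) *
      slot₂₃ (D.ω⁻¹).val g
  /-- `g χ(h₁) h₂ = h₁ χ(h₂) g`. -/
  comm : ∀ h : H,
    D.mul (g ⊗ₜ[k] TensorProduct.lid k H (LinearMap.rTensor H χ (Coalgebra.comul h))) =
      D.mul (TensorProduct.rid k H (LinearMap.lTensor H χ (Coalgebra.comul h)) ⊗ₜ[k] g)

/-! ## Yetter-Drinfeld modules -/

/-- A `k`-vector space with a left coaction and a left action of `H`, no axioms yet. -/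
structure ActCoact (k : Type u) (H : Type v) [Field k] [AddCommGroup H] [Module k H] where
  carrier : Type u
  [instAddCommGroup : AddCommGroup carrier]
  [instModule : Module k carrier]
  /-- The coaction `ρ`. -/
  coact : carrier →ₗ[k] H ⊗[k] carrier
  /-- The action `h ⊗ x ↦ h ▷ x`. -/
  act : H ⊗[k] carrier →ₗ[k] carrier

attribute [instance] ActCoact.instAddCommGroup ActCoact.instModule

instance {k : Type u} {H : Type v} [Field k] [AddCommGroup H] [Module k H] :
    CoeSort (ActCoact k H) (Type u) := ⟨ActCoact.carrier⟩

section Operations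

variable {k : Type u} {H : Type v} [Field k] [AddCommGroup H] [Module k H]

/-- `u ⊗ v ⊗ w ↦ f(u₋₁ ⊗ v₋₁ ⊗ w₋₁) u₀ ⊗ v₀ ⊗ w₀` for coactions `ρU`, `ρV`, `ρW`. -/
def twist {U V W : Type*} [AddCommGroup U] [Module k U] [AddCommGroup V] [Module k V]
    [AddCommGroup W] [Module k W] (f : WithConv (H ⊗[k] (H ⊗[k] H) →ₗ[k] k))
    (ρU : U →ₗ[k] H ⊗[k] U) (ρV : V →ₗ[k] H ⊗[k] V) (ρW : W →ₗ[k] H ⊗[k] W) :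
    U ⊗[k] (V ⊗[k] W) →ₗ[k] U ⊗[k] (V ⊗[k] W) :=
  (TensorProduct.lid k (U ⊗[k] (V ⊗[k] W))).toLinearMap ∘ₗ
    LinearMap.rTensor (U ⊗[k] (V ⊗[k] W)) f.ofConv ∘ₗ
    (TensorProduct.tensorTensorTensorComm k H U (H ⊗[k] H) (V ⊗[k] W)).toLinearMap ∘ₗ
    LinearMap.lTensor (H ⊗[k] U)
      (TensorProduct.tensorTensorTensorComm k H V H W).toLinearMap ∘ₗ
    TensorProduct.map ρU (TensorProduct.map ρV ρW)

/-- `h ⊗ w ↦ (h₁ ▷ w) ⊗ h₂` for an action `μ`. -/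
def halfBraid [Coalgebra k H] {W : Type*} [AddCommGroup W] [Module k W]
    (μ : H ⊗[k] W →ₗ[k] W) : H ⊗[k] W →ₗ[k] W ⊗[k] H :=
  LinearMap.rTensor H μ ∘ₗ (TensorProduct.rightComm k H H W).toLinearMap ∘ₗ
    LinearMap.rTensor W Coalgebra.comul

end Operations

namespace DualQuasiBialgebra

variable {k : Type u} {H : Type v} [Field k] [AddCommGroup H] [Module k H] [Coalgebra k H]

/-- The associativity constraint
`(u ⊗ v) ⊗ w ↦ ω⁻¹(u₋₁ ⊗ v₋₁ ⊗ w₋₁) u₀ ⊗ (v₀ ⊗ w₀)` of left `H`-comodules. -/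
def assocMap (D : DualQuasiBialgebra k H) {U V W : Type*} [AddCommGroup U] [Module k U]
    [AddCommGroup V] [Module k V] [AddCommGroup W] [Module k W]
    (ρU : U →ₗ[k] H ⊗[k] U) (ρV : V →ₗ[k] H ⊗[k] V) (ρW : W →ₗ[k] H ⊗[k] W) :
    (U ⊗[k] V) ⊗[k] W →ₗ[k] U ⊗[k] (V ⊗[k] W) :=
  twist (D.ω⁻¹).val ρU ρV ρW ∘ₗ (TensorProduct.assoc k U V W).toLinearMap

/-- The inverse constraint `u ⊗ (v ⊗ w) ↦ ω(u₋₁ ⊗ v₋₁ ⊗ w₋₁) (u₀ ⊗ v₀) ⊗ w₀`. -/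
def assocInvMap (D : DualQuasiBialgebra k H) {U V W : Type*} [AddCommGroup U] [Module k U]
    [AddCommGroup V] [Module k V] [AddCommGroup W] [Module k W]
    (ρU : U →ₗ[k] H ⊗[k] U) (ρV : V →ₗ[k] H ⊗[k] V) (ρW : W →ₗ[k] H ⊗[k] W) :
    U ⊗[k] (V ⊗[k] W) →ₗ[k] (U ⊗[k] V) ⊗[k] W :=
  (TensorProduct.assoc k U V W).symm.toLinearMap ∘ₗ twist D.ω.val ρU ρV ρW

/-- The right-hand side of the associativity axiom of a Yetter-Drinfeld module: the map sending
`(h ⊗ l) ⊗ v` to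
`ω⁻¹(h₁ ⊗ l₁ ⊗ v₋₁) ω(h₂ ⊗ (l₂ ▷ v₀)₋₁ ⊗ l₃) ω⁻¹((h₃ ▷ (l₂ ▷ v₀)₀)₋₁ ⊗ h₄ ⊗ l₄)
(h₃ ▷ (l₂ ▷ v₀)₀)₀`.  It is written as the composite
`(h ⊗ l) ⊗ v ↦ ω⁻¹(h₁ ⊗ l₁ ⊗ v₋₁) h₂ ⊗ (l₂ ⊗ v₀)`, `l ⊗ v ↦ (l₁ ▷ v) ⊗ l₂`,
`h ⊗ (v ⊗ l) ↦ ω(h₁ ⊗ v₋₁ ⊗ l₁) (h₂ ⊗ v₀) ⊗ l₂`, `h ⊗ v ↦ (h₁ ▷ v) ⊗ h₂`,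
`(v ⊗ h) ⊗ l ↦ ω⁻¹(v₋₁ ⊗ h₁ ⊗ l₁) v₀ ⊗ (h₂ ⊗ l₂)`, followed by `ε` on the last two factors. -/
def iteratedAct (D : DualQuasiBialgebra k H) (V : ActCoact k H) : (H ⊗[k] H) ⊗[k] V →ₗ[k] V :=
  (TensorProduct.rid k V).toLinearMap ∘ₗ
    LinearMap.lTensor V (Coalgebra.counit (R := k) (A := H ⊗[k] H)) ∘ₗ
    D.assocMap V.coact (Coalgebra.comul (A := H)) (Coalgebra.comul (A := H)) ∘ₗ
    LinearMap.rTensor H (halfBraid V.act) ∘ₗ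
    D.assocInvMap (Coalgebra.comul (A := H)) V.coact (Coalgebra.comul (A := H)) ∘ₗ
    LinearMap.lTensor H (halfBraid V.act) ∘ₗ
    D.assocMap (Coalgebra.comul (A := H)) (Coalgebra.comul (A := H)) V.coact

/-- `V` is an object of the category of Yetter-Drinfeld modules over the dual
quasi-bialgebra. -/
structure IsYetterDrinfeld (D : DualQuasiBialgebra k H) (V : ActCoact k H) : Prop where
  /-- `(Δ ⊗ V) ρ = (H ⊗ ρ) ρ`. -/
  coact_coassoc : (TensorProduct.assoc k H H V).toLinearMap ∘ₗ
      LinearMap.rTensor V Coalgebra.comul ∘ₗ V.coact = LinearMap.lTensor H V.coact ∘ₗ V.coact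
  /-- `(ε ⊗ V) ρ = V`. -/
  coact_counit : (TensorProduct.lid k V).toLinearMap ∘ₗ
      LinearMap.rTensor V Coalgebra.counit ∘ₗ V.coact = LinearMap.id
  mul_act : V.act ∘ₗ LinearMap.rTensor V D.mul.toLinearMap = D.iteratedAct V
  one_act : ∀ x : V, V.act (D.one ⊗ₜ[k] x) = x
  /-- `(h₁ ▷ x)₋₁ h₂ ⊗ (h₁ ▷ x)₀ = h₁ x₋₁ ⊗ (h₂ ▷ x₀)`. -/
  compat : LinearMap.rTensor V D.mul.toLinearMap ∘ₗ
      (TensorProduct.rightComm k H V H).toLinearMap ∘ₗ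
      LinearMap.rTensor H V.coact ∘ₗ halfBraid V.act =
    TensorProduct.map D.mul.toLinearMap V.act ∘ₗ
      (TensorProduct.tensorTensorTensorComm k H H H V).toLinearMap ∘ₗ
      TensorProduct.map Coalgebra.comul V.coact

/-- Morphisms of Yetter-Drinfeld modules: linear maps that commute with coactions and actions. -/
structure _root_.ActCoact.IsHom {V W : ActCoact k H} (f : V →ₗ[k] W) : Prop where
  coact : W.coact ∘ₗ f = LinearMap.lTensor H f ∘ₗ V.coact
  act : f ∘ₗ V.act = W.act ∘ₗ LinearMap.lTensor H f

/-- The unit object `k`, with `ρ(x) = 1_H ⊗ x` and `h ▷ x = ε(h) x`. -/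
abbrev unitObj (D : DualQuasiBialgebra k H) : ActCoact k H where
  carrier := k
  coact := TensorProduct.mk k H k D.one
  act := (TensorProduct.lid k k).toLinearMap ∘ₗ LinearMap.rTensor k Coalgebra.counit

/-- The diagonal coaction `v ⊗ w ↦ v₋₁ w₋₁ ⊗ (v₀ ⊗ w₀)`. -/
def tensorCoact (D : DualQuasiBialgebra k H) (V W : ActCoact k H) :
    V ⊗[k] W →ₗ[k] H ⊗[k] (V ⊗[k] W) :=
  LinearMap.rTensor (V ⊗[k] W) D.mul.toLinearMap ∘ₗ
    (TensorProduct.tensorTensorTensorComm k H V H W).toLinearMap ∘ₗ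
    TensorProduct.map V.coact W.coact

/-- The action on a tensor product: `h ⊗ (v ⊗ w)` is sent to
`ω(h₁ ⊗ v₋₁ ⊗ w₋₂) ω⁻¹((h₂ ▷ v₀)₋₂ ⊗ h₃ ⊗ w₋₁) ω((h₂ ▷ v₀)₋₁ ⊗ (h₄ ▷ w₀)₋₁ ⊗ h₅)
(h₂ ▷ v₀)₀ ⊗ (h₄ ▷ w₀)₀`.  It is written as the composite
`h ⊗ (v ⊗ w) ↦ ω(h₁ ⊗ v₋₁ ⊗ w₋₁) (h₂ ⊗ v₀) ⊗ w₀`, `h ⊗ v ↦ (h₁ ▷ v) ⊗ h₂`,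
`(v ⊗ h) ⊗ w ↦ ω⁻¹(v₋₁ ⊗ h₁ ⊗ w₋₁) v₀ ⊗ (h₂ ⊗ w₀)`, `h ⊗ w ↦ (h₁ ▷ w) ⊗ h₂`,
`v ⊗ (w ⊗ h) ↦ ω(v₋₁ ⊗ w₋₁ ⊗ h₁) (v₀ ⊗ w₀) ⊗ h₂`, followed by `ε` on the last factor. -/
def tensorAct (D : DualQuasiBialgebra k H) (V W : ActCoact k H) :
    H ⊗[k] (V ⊗[k] W) →ₗ[k] V ⊗[k] W :=
  (TensorProduct.rid k (V ⊗[k] W)).toLinearMap ∘ₗ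
    LinearMap.lTensor (V ⊗[k] W) (Coalgebra.counit (R := k) (A := H)) ∘ₗ
    D.assocInvMap V.coact W.coact (Coalgebra.comul (A := H)) ∘ₗ
    LinearMap.lTensor V (halfBraid W.act) ∘ₗ
    D.assocMap V.coact (Coalgebra.comul (A := H)) W.coact ∘ₗ
    LinearMap.rTensor W (halfBraid V.act) ∘ₗ
    D.assocInvMap (Coalgebra.comul (A := H)) V.coact W.coact

/-- The tensor product of Yetter-Drinfeld modules. -/
abbrev tensorObj (D : DualQuasiBialgebra k H) (V W : ActCoact k H) : ActCoact k H where
  carrier := V ⊗[k] W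
  coact := D.tensorCoact V W
  act := D.tensorAct V W

/-- The prebraiding `v ⊗ w ↦ (v₋₁ ▷ w) ⊗ v₀`. -/
def _root_.ActCoact.braid (V W : ActCoact k H) : V ⊗[k] W →ₗ[k] W ⊗[k] V :=
  LinearMap.rTensor V W.act ∘ₗ (TensorProduct.rightComm k H V W).toLinearMap ∘ₗ
    LinearMap.rTensor W V.coact

/-- The middle-four interchange
`a⁻¹_{U,W,V⊗Z} (U ⊗ a_{W,V,Z}) (U ⊗ c_{V,W} ⊗ Z) (U ⊗ a⁻¹_{V,W,Z}) a_{U,V,W⊗Z}`. -/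
def interchange (D : DualQuasiBialgebra k H) (U V W Z : ActCoact k H) :
    (U ⊗[k] V) ⊗[k] (W ⊗[k] Z) →ₗ[k] (U ⊗[k] W) ⊗[k] (V ⊗[k] Z) :=
  D.assocInvMap U.coact W.coact (D.tensorCoact V Z) ∘ₗ
    LinearMap.lTensor U (D.assocMap W.coact V.coact Z.coact) ∘ₗ
    LinearMap.lTensor U (LinearMap.rTensor Z (V.braid W)) ∘ₗ
    LinearMap.lTensor U (D.assocInvMap V.coact W.coact Z.coact) ∘ₗ
    D.assocMap U.coact V.coact (D.tensorCoact W Z)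

/-! ## Algebras, coalgebras and bialgebras in the category of Yetter-Drinfeld modules -/

/-- `(A, m, e)` is an algebra in the category of Yetter-Drinfeld modules; `e` is the image of `1`
under the unit morphism. -/
structure IsAlgebra (D : DualQuasiBialgebra k H) (A : ActCoact k H) (m : A ⊗[k] A →ₗ[k] A)
    (e : A) : Prop where
  isYD : D.IsYetterDrinfeld A
  mul_hom : ActCoact.IsHom (V := D.tensorObj A A) (W := A) m
  one_hom : ActCoact.IsHom (V := D.unitObj) (W := A) (LinearMap.toSpanSingleton k A e)
  /-- `m (m ⊗ A) = m (A ⊗ m) a`. -/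
  mul_assoc : m ∘ₗ LinearMap.rTensor A m =
    m ∘ₗ LinearMap.lTensor A m ∘ₗ D.assocMap A.coact A.coact A.coact
  one_mul : ∀ x : A, m (e ⊗ₜ[k] x) = x
  mul_one : ∀ x : A, m (x ⊗ₜ[k] e) = x

/-- `(C, Δ, ε)` is a coalgebra in the category of Yetter-Drinfeld modules. -/
structure IsCoalgebra (D : DualQuasiBialgebra k H) (C : ActCoact k H) (Δ : C →ₗ[k] C ⊗[k] C)
    (ε : C →ₗ[k] k) : Prop where
  isYD : D.IsYetterDrinfeld C
  comul_hom : ActCoact.IsHom (V := C) (W := D.tensorObj C C) Δ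
  counit_hom : ActCoact.IsHom (V := C) (W := D.unitObj) ε
  /-- `a (Δ ⊗ C) Δ = (C ⊗ Δ) Δ`. -/
  coassoc : D.assocMap C.coact C.coact C.coact ∘ₗ LinearMap.rTensor C Δ ∘ₗ Δ =
    LinearMap.lTensor C Δ ∘ₗ Δ
  counit_comul : (TensorProduct.lid k C).toLinearMap ∘ₗ LinearMap.rTensor C ε ∘ₗ Δ = LinearMap.id
  comul_counit : (TensorProduct.rid k C).toLinearMap ∘ₗ LinearMap.lTensor C ε ∘ₗ Δ = LinearMap.id

/-- `(B, m, e, Δ, ε)` is a bialgebra in the category of Yetter-Drinfeld modules: `Δ` and `ε` are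
algebra maps, where `B ⊗ B` carries the multiplication `(m ⊗ m) Ω` built from the prebraiding. -/
structure IsBialgebra (D : DualQuasiBialgebra k H) (B : ActCoact k H) (m : B ⊗[k] B →ₗ[k] B)
    (e : B) (Δ : B →ₗ[k] B ⊗[k] B) (ε : B →ₗ[k] k) : Prop where
  isAlgebra : D.IsAlgebra B m e
  isCoalgebra : D.IsCoalgebra B Δ ε
  comul_mul : Δ ∘ₗ m = TensorProduct.map m m ∘ₗ D.interchange B B B B ∘ₗ TensorProduct.map Δ Δ
  comul_one : Δ e = e ⊗ₜ[k] e
  counit_mul : ∀ x y : B, ε (m (x ⊗ₜ[k] y)) = ε x * ε y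
  counit_one : ε e = 1

/-! ## The tensor algebra -/

/-- The tensor powers `T⁰(V) = k`, `T¹(V) = V`, `Tⁿ(V) = V ⊗ Tⁿ⁻¹(V)` for `n > 1`. -/
def tpow (D : DualQuasiBialgebra k H) (V : ActCoact k H) : ℕ → ActCoact k H
  | 0 => D.unitObj
  | 1 => V
  | n + 2 => D.tensorObj V (D.tpow V (n + 1))

/-- The tensor algebra `T(V) = ⨁ n, Tⁿ(V)`, with the coaction and the action of the coproduct of
the `Tⁿ(V)`. -/
abbrev tensorAlg (D : DualQuasiBialgebra k H) (V : ActCoact k H) : ActCoact k H where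
  carrier := DirectSum ℕ fun n => (D.tpow V n).carrier
  coact := DirectSum.toModule k ℕ _ fun n =>
    LinearMap.lTensor H (DirectSum.lof k ℕ (fun n => (D.tpow V n).carrier) n) ∘ₗ
      (D.tpow V n).coact
  act := TensorProduct.lift (LinearMap.flip (DirectSum.toModule k ℕ _ fun n =>
    (TensorProduct.curry (DirectSum.lof k ℕ (fun n => (D.tpow V n).carrier) n ∘ₗ
      (D.tpow V n).act)).flip))

/-- The inclusion `Tⁿ(V) → T(V)`. -/
def incl (D : DualQuasiBialgebra k H) (V : ActCoact k H) (n : ℕ) :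
    D.tpow V n →ₗ[k] D.tensorAlg V :=
  DirectSum.lof k ℕ (fun n => (D.tpow V n).carrier) n

/-- The canonical isomorphism `V ⊗ Tⁿ(V) → Tⁿ⁺¹(V)`: the right unit constraint for `n = 0`, the
identity otherwise. -/
def consPow (D : DualQuasiBialgebra k H) (V : ActCoact k H) :
    ∀ n : ℕ, V ⊗[k] D.tpow V n →ₗ[k] D.tpow V (n + 1)
  | 0 => (TensorProduct.rid k V).toLinearMap
  | _ + 1 => LinearMap.id

/-- The map `V ⊗ T(V) → T(V)` assembled from the isomorphisms `V ⊗ Tⁿ(V) → Tⁿ⁺¹(V)`. -/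
def cons (D : DualQuasiBialgebra k H) (V : ActCoact k H) :
    V ⊗[k] D.tensorAlg V →ₗ[k] D.tensorAlg V :=
  TensorProduct.lift (LinearMap.flip (DirectSum.toModule k ℕ _ fun n =>
    (TensorProduct.curry (D.incl V (n + 1) ∘ₗ D.consPow V n)).flip))

/-- The multiplication `Tⁿ(V) ⊗ T(V) → T(V)`: on `T⁰` the left unit constraint, on `T¹` the
concatenation `V ⊗ T(V) → T(V)`, and on `Tⁿ⁺¹ = V ⊗ Tⁿ` it is
`(v ⊗ x) y = ω⁻¹(v₋₁ ⊗ x₋₁ ⊗ y₋₁) v₀ (x₀ y₀)`. -/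
def mulPow (D : DualQuasiBialgebra k H) (V : ActCoact k H) :
    ∀ n : ℕ, D.tpow V n ⊗[k] D.tensorAlg V →ₗ[k] D.tensorAlg V
  | 0 => (TensorProduct.lid k (D.tensorAlg V)).toLinearMap
  | 1 => D.cons V
  | n + 2 => D.cons V ∘ₗ LinearMap.lTensor V (D.mulPow V (n + 1)) ∘ₗ
      D.assocMap V.coact (D.tpow V (n + 1)).coact (D.tensorAlg V).coact

/-- The multiplication of the tensor algebra. -/
def tmul (D : DualQuasiBialgebra k H) (V : ActCoact k H) :
    D.tensorAlg V ⊗[k] D.tensorAlg V →ₗ[k] D.tensorAlg V :=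
  TensorProduct.lift (DirectSum.toModule k ℕ _ fun n => TensorProduct.curry (D.mulPow V n))

/-- The unit `1 ∈ k = T⁰(V)` of the tensor algebra. -/
def tone (D : DualQuasiBialgebra k H) (V : ActCoact k H) : D.tensorAlg V :=
  D.incl V 0 (1 : k)

/-- The elements `v^[0] = 1`, `v^[1] = v`, `v^[n] = v ⊗ v^[n-1]` for `n > 1`, in `Tⁿ(V)`. -/
def vpowAux (D : DualQuasiBialgebra k H) (V : ActCoact k H) (x : V) : ∀ n : ℕ, D.tpow V n
  | 0 => (1 : k)
  | 1 => x
  | n + 2 => x ⊗ₜ[k] D.vpowAux V x (n + 1)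

/-- The elements `v^[n]` of `T(V)`. -/
def vpow (D : DualQuasiBialgebra k H) (V : ActCoact k H) (x : V) (n : ℕ) : D.tensorAlg V :=
  D.incl V n (D.vpowAux V x n)

/-- The comultiplication and counit `Δ`, `ε` make `T(V)` a bialgebra in the category of
Yetter-Drinfeld modules in which the elements of `V` are primitive. -/
structure IsTensorBialgebra (D : DualQuasiBialgebra k H) (V : ActCoact k H)
    (Δ : D.tensorAlg V →ₗ[k] D.tensorAlg V ⊗[k] D.tensorAlg V)
    (ε : D.tensorAlg V →ₗ[k] k) : Prop where
  isBialgebra : D.IsBialgebra (D.tensorAlg V) (D.tmul V) (D.tone V) Δ ε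
  comul_incl : ∀ x : V, Δ (D.incl V 1 x) =
    D.incl V 1 x ⊗ₜ[k] D.tone V + D.tone V ⊗ₜ[k] D.incl V 1 x
  counit_incl : ∀ x : V, ε (D.incl V 1 x) = 0

/-- `T(V)` is the free algebra on `V` in the category of Yetter-Drinfeld modules: it is an algebra,
`V → T(V)` is a morphism, and every morphism from `V` to an algebra `A` in this category extends
uniquely to a morphism of algebras `T(V) → A`. -/
structure IsFreeAlgebra (D : DualQuasiBialgebra k H) (V : ActCoact k H) : Prop where
  isAlgebra : D.IsAlgebra (D.tensorAlg V) (D.tmul V) (D.tone V)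
  incl_hom : ActCoact.IsHom (V := V) (W := D.tensorAlg V) (D.incl V 1)
  exists_unique_lift : ∀ (A : ActCoact k H) (m : A ⊗[k] A →ₗ[k] A) (e : A), D.IsAlgebra A m e →
    ∀ f : V →ₗ[k] A, ActCoact.IsHom f →
      ∃! F : D.tensorAlg V →ₗ[k] A, ActCoact.IsHom F ∧
        F ∘ₗ D.tmul V = m ∘ₗ TensorProduct.map F F ∧ F (D.tone V) = e ∧
        ∀ x : V, F (D.incl V 1 x) = f x

/-! ## The one-dimensional Yetter-Drinfeld module of a quasi-Yetter-Drinfeld datum -/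

/-- The space `V` with coaction `ρ(x) = g ⊗ x` and action `h ▷ x = χ(h) x`. -/
abbrev _root_.ActCoact.ofDatum (g : H) (χ : H →ₗ[k] k) (V : Type u) [AddCommGroup V] [Module k V] :
    ActCoact k H where
  carrier := V
  coact := TensorProduct.mk k H V g
  act := (TensorProduct.lid k V).toLinearMap ∘ₗ LinearMap.rTensor V χ

/-- `χ_[0] = ε` and
`χ_[n] = ω(- ⊗ g ⊗ gⁿ⁻¹) * χ * ω⁻¹(g ⊗ - ⊗ gⁿ⁻¹) * χ_[n-1] * ω(g ⊗ gⁿ⁻¹ ⊗ -)` for `n ≥ 1`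
(convolution products). -/
def chiPow (D : DualQuasiBialgebra k H) (g : H) (χ : H →ₗ[k] k) : ℕ → WithConv (H →ₗ[k] k)
  | 0 => WithConv.toConv Coalgebra.counit
  | n + 1 => slot₁ D.ω.val g (D.pow g n) * WithConv.toConv χ * slot₂ (D.ω⁻¹).val g (D.pow g n) *
      D.chiPow g χ n * slot₃ D.ω.val g (D.pow g n)

end DualQuasiBialgebra

/-- The Gaussian binomial coefficient, evaluated at `q`, through the `q`-Pascal rule. -/
def qBinom {k : Type u} [Field k] (q : k) : ℕ → ℕ → k
  | _, 0 => 1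
  | 0, _ + 1 => 0
  | n + 1, i + 1 => qBinom q n i + q ^ (i + 1) * qBinom q n (i + 1)

/-- The quantum factorial `∏_{1 ≤ m ≤ n} (1 + q + ... + q^(m-1))`. -/
def qFactorial {k : Type u} [Field k] (q : k) (n : ℕ) : k :=
  ∏ m ∈ Finset.range n, ∑ j ∈ Finset.range (m + 1), q ^ j

theorem qBinom_eq_zero {k : Type u} [Field k] (q : k) :
    ∀ n i : ℕ, n < i → qBinom q n i = 0
  | _, 0, h => absurd h (Nat.not_lt_zero _)
  | 0, i + 1, _ => by simp [qBinom]
  | n + 1, i + 1, h => by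
    simp [qBinom, qBinom_eq_zero q n i (by omega), qBinom_eq_zero q n (i + 1) (by omega)]

/-- The usual quotient formula `(n choose i)_q = (n)_q! / ((i)_q! (n-i)_q!)`, without division. -/
theorem qBinom_mul_qFactorial {k : Type u} [Field k] (q : k) :
    ∀ i j : ℕ, qBinom q (i + j) i * (qFactorial q i * qFactorial q j) = qFactorial q (i + j)
  | 0, j => by simp [qBinom, qFactorial]
  | i + 1, 0 => by
    have h := qBinom_mul_qFactorial q i 0
    have hi : qBinom q i (i + 1) = 0 := qBinom_eq_zero q _ _ (by omega)
    simp only [qFactorial, Finset.prod_range_zero, mul_one, add_zero, qBinom, hi, mul_zero,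
      Finset.prod_range_succ _ i] at h ⊢
    rw [← mul_assoc, h]
  | i + 1, j + 1 => by
    have h1 := qBinom_mul_qFactorial q i (j + 1)
    have h2 := qBinom_mul_qFactorial q (i + 1) j
    have e1 : i + 1 + (j + 1) = (i + (j + 1)) + 1 := by omega
    have e2 : i + 1 + j = i + (j + 1) := by omega
    rw [e2] at h2
    have hs : ∑ l ∈ Finset.range (i + (j + 1) + 1), q ^ l =
        (∑ l ∈ Finset.range (i + 1), q ^ l) +
          q ^ (i + 1) * ∑ l ∈ Finset.range (j + 1), q ^ l := by
      rw [show i + (j + 1) + 1 = (i + 1) + (j + 1) by omega, Finset.sum_range_add,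
        Finset.mul_sum]
      simp only [pow_add]
    have fs : ∀ n : ℕ, qFactorial q (n + 1) =
        qFactorial q n * ∑ l ∈ Finset.range (n + 1), q ^ l := fun n => by
      simp only [qFactorial, Finset.prod_range_succ]
    have b : qBinom q (i + (j + 1) + 1) (i + 1) =
        qBinom q (i + (j + 1)) i + q ^ (i + 1) * qBinom q (i + (j + 1)) (i + 1) := by
      simp [qBinom]
    rw [e1, b, fs (i + (j + 1)), hs]
    rw [fs i] at h2 ⊢
    rw [fs j] at h1 ⊢
    linear_combination (∑ l ∈ Finset.range (i + 1), q ^ l) * h1 +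
      q ^ (i + 1) * (∑ l ∈ Finset.range (j + 1), q ^ l) * h2

/-- The coefficient `β(i, n) = (n choose i)_q ∏_{0 ≤ j ≤ i-1} ω(g ⊗ g^j ⊗ g^{n-i})`, `i ≤ n`. -/
def DualQuasiBialgebra.beta {k : Type u} {H : Type v} [Field k] [AddCommGroup H] [Module k H]
    [Coalgebra k H] (D : DualQuasiBialgebra k H) (g : H) (q : k) (i n : ℕ) : k :=
  qBinom q n i * ∏ j ∈ Finset.range i, D.om g (D.pow g j) (D.pow g (n - i))

end

/-!
A quasi-Yetter-Drinfeld datum `(g, χ)` amounts to a structure of Yetter-Drinfeld module on a line,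
so the tensor product of lines multiplies data: `(g, χ) (g', χ') = (g g', χ'')` with
`χ'' = ω(- ⊗ g ⊗ g') * χ * ω⁻¹(g ⊗ - ⊗ g') * χ' * ω(g ⊗ g' ⊗ -)`. The product is again a datum
(`IsQuasiYDDatum.chiMul`). The associativity constraint of lines is a scalar, hence the product of
data is strictly associative (`chiMul_assoc`) and data form a monoid, `YDDatum`. In it the powers
of `(g, χ)` are `(g ^ n, χ_[n])`. Stability under products and associativity are the only places
where the cocycle condition is needed for arbitrary elements of `H`; they are checked in convolution
algebras of functionals, where the cocycle condition is an identity between units and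
`g χ(h₁) h₂ = h₁ χ(h₂) g` is a commutation rule.

A module spanned by elements that are homogeneous for some datum satisfies the axioms of a
Yetter-Drinfeld module (`SpannedByHomog.isYetterDrinfeld`), and all the structural maps, namely
the associativity constraint, the prebraiding and the middle-four interchange, act on homogeneous
elements by scalars, up to the evident flips. Tensor products of homogeneous elements are
homogeneous for the product datum, so `v^[n]` is homogeneous for the `n`-th power of `(g, χ)`.
Hence `T(V)` is described by the basis `v^[n]` and by the values of `ω` and `χ` on powers of `g`.

By construction `v^[a] v^[b] = μ(a, b) v^[a+b]` with `μ(a, b) = ∏ ω⁻¹(g ⊗ g^i ⊗ g^b)`. By the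
cocycle condition `ω` is the coboundary of `μ` on powers of `g` (`YDDatum.om_pow_mul_mu`), and
`χ_[n](g^j) = q^(jn) μ(j, n) / μ(n, j)` (`YDDatum.chi_pow`). So `T(V)` is the polynomial algebra
with its usual `q`-braiding, twisted by the cochain `μ`, and
`β(i, i + j) = binom(i + j, i)_q / μ(i, j)` are the twisted Gaussian coefficients. All the values of `μ` cancel from the axioms of a
bialgebra: coassociativity becomes the identity `qBinom_mul_qBinom` for Gaussian trinomial
coefficients, and multiplicativity of the comultiplication becomes the identity `qVandermonde`.
Freeness and uniqueness hold because `v^[n+1] = v v^[n]`: a morphism of algebras, or a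
comultiplication, is determined by its value on `v`, and the right-bracketed powers of a
homogeneous element of an algebra multiply with the same constants `μ`.
-/

noncomputable section

/-! ### Functionals on coalgebras -/

section Functionals

variable {k : Type*} [Field k] {C E : Type*} [AddCommGroup C] [Module k C] [AddCommGroup E]
  [Module k E]

/-- Functionals separate the points of a vector space. -/
theorem eq_of_functionals {a b : C} (h : ∀ f : C →ₗ[k] k, f a = f b) : a = b :=
  (Module.forall_dual_apply_eq_zero_iff k (a - b)).mp (fun f => by
    simp [h f]) |> sub_eq_zero.mp

/-- `x ⊗ y` as a functional on `C ⊗ E`. -/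
def tens (x : WithConv (C →ₗ[k] k)) (y : WithConv (E →ₗ[k] k)) : WithConv (C ⊗[k] E →ₗ[k] k) :=
  WithConv.toConv ((TensorProduct.lid k k).toLinearMap ∘ₗ TensorProduct.map x.ofConv y.ofConv)

@[simp] theorem tens_apply (x : WithConv (C →ₗ[k] k)) (y : WithConv (E →ₗ[k] k)) (c : C) (e : E) :
    (tens x y).ofConv (c ⊗ₜ[k] e) = x.ofConv c * y.ofConv e := by
  simp [tens]

end Functionals

section Convolution

variable {k : Type*} [Field k]
variable {C : Type*} [AddCommGroup C] [Module k C] [Coalgebra k C]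
variable {E : Type*} [AddCommGroup E] [Module k E] [Coalgebra k E]

/-- Restriction of functionals along a coalgebra map, as a homomorphism of convolution
algebras. -/
def pull (φ : C →ₗc[k] E) : WithConv (E →ₗ[k] k) →* WithConv (C →ₗ[k] k) where
  toFun f := WithConv.toConv (f.ofConv ∘ₗ φ.toLinearMap)
  map_one' := by
    ext c
    simp [LinearMap.convOne_def]
  map_mul' f g := by
    rw [LinearMap.convMul_comp_coalgHom_distrib]

@[simp] theorem pull_apply (φ : C →ₗc[k] E) (f : WithConv (E →ₗ[k] k)) (c : C) :
    (pull φ f).ofConv c = f.ofConv (φ c) := rfl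

/-- `c ↦ x(c₁) c₂`. -/
def hitL (x : WithConv (C →ₗ[k] k)) : C →ₗ[k] C :=
  (TensorProduct.lid k C).toLinearMap ∘ₗ LinearMap.rTensor C x.ofConv ∘ₗ Coalgebra.comul

/-- `c ↦ c₁ x(c₂)`. -/
def hitR (x : WithConv (C →ₗ[k] k)) : C →ₗ[k] C :=
  (TensorProduct.rid k C).toLinearMap ∘ₗ LinearMap.lTensor C x.ofConv ∘ₗ Coalgebra.comul

theorem conv_mul_apply_hitL (x y : WithConv (C →ₗ[k] k)) (c : C) :
    (x * y).ofConv c = y.ofConv (hitL x c) := by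
  change LinearMap.mul' k k (TensorProduct.map x.ofConv y.ofConv (Coalgebra.comul c)) = _
  simp only [hitL, LinearMap.comp_apply]
  induction Coalgebra.comul (R := k) c with
  | zero => simp
  | add _ _ h₁ h₂ => simp only [map_add, h₁, h₂]
  | tmul a b => simp

theorem conv_mul_apply_hitR (x y : WithConv (C →ₗ[k] k)) (c : C) :
    (x * y).ofConv c = x.ofConv (hitR y c) := by
  change LinearMap.mul' k k (TensorProduct.map x.ofConv y.ofConv (Coalgebra.comul c)) = _
  simp only [hitR, LinearMap.comp_apply]
  induction Coalgebra.comul (R := k) c with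
  | zero => simp
  | add _ _ h₁ h₂ => simp only [map_add, h₁, h₂]
  | tmul a b => simp [mul_comm]

theorem counit_hitL (x : WithConv (C →ₗ[k] k)) (c : C) :
    Coalgebra.counit (R := k) (hitL x c) = x.ofConv c := by
  have := conv_mul_apply_hitL x 1 c
  rw [mul_one] at this
  rw [this]; rfl

@[simp] theorem hitL_one (c : C) : hitL (1 : WithConv (C →ₗ[k] k)) c = c := by
  simp only [hitL, LinearMap.comp_apply]
  change (TensorProduct.lid k C) (LinearMap.rTensor C (Coalgebra.counit (R := k))
    (Coalgebra.comul c)) = c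
  simp

@[simp] theorem hitR_one (c : C) : hitR (1 : WithConv (C →ₗ[k] k)) c = c := by
  simp only [hitR, LinearMap.comp_apply]
  change (TensorProduct.rid k C) (LinearMap.lTensor C (Coalgebra.counit (R := k))
    (Coalgebra.comul c)) = c
  simp

theorem hitL_hitL (x y : WithConv (C →ₗ[k] k)) (c : C) : hitL y (hitL x c) = hitL (x * y) c := by
  refine eq_of_functionals (k := k) fun f => ?_
  have h₁ := conv_mul_apply_hitL y (WithConv.toConv f) (hitL x c)
  have h₂ := conv_mul_apply_hitL (x * y) (WithConv.toConv f) c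
  have h₃ := conv_mul_apply_hitL x (y * WithConv.toConv f) c
  rw [← h₃, ← mul_assoc] at h₁
  exact h₁.symm.trans h₂

theorem hitL_tens (x : WithConv (C →ₗ[k] k)) (y : WithConv (E →ₗ[k] k)) (c : C) (e : E) :
    hitL (tens x y) (c ⊗ₜ[k] e) = hitL x c ⊗ₜ[k] hitL y e := by
  simp only [hitL, LinearMap.comp_apply, TensorProduct.comul_tmul]
  induction Coalgebra.comul (R := k) c with
  | zero => simp
  | add _ _ h₁ h₂ => simp only [map_add, TensorProduct.add_tmul, h₁, h₂]
  | tmul a b =>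
    induction Coalgebra.comul (R := k) e with
    | zero => simp
    | add _ _ h₁ h₂ => simp only [map_add, TensorProduct.tmul_add, h₁, h₂]
    | tmul a' b' => simp [TensorProduct.smul_tmul', TensorProduct.tmul_smul, smul_smul, mul_comm]

theorem hitR_tens (x : WithConv (C →ₗ[k] k)) (y : WithConv (E →ₗ[k] k)) (c : C) (e : E) :
    hitR (tens x y) (c ⊗ₜ[k] e) = hitR x c ⊗ₜ[k] hitR y e := by
  simp only [hitR, LinearMap.comp_apply, TensorProduct.comul_tmul]
  induction Coalgebra.comul (R := k) c with
  | zero => simp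
  | add _ _ h₁ h₂ => simp only [map_add, TensorProduct.add_tmul, h₁, h₂]
  | tmul a b =>
    induction Coalgebra.comul (R := k) e with
    | zero => simp
    | add _ _ h₁ h₂ => simp only [map_add, TensorProduct.tmul_add, h₁, h₂]
    | tmul a' b' => simp [TensorProduct.smul_tmul', TensorProduct.tmul_smul, smul_smul, mul_comm]

/-- The two functionals `x ⊗ ε` and `ε ⊗ y` commute. -/
theorem tens_one_mul_one_tens (x : WithConv (C →ₗ[k] k)) (y : WithConv (E →ₗ[k] k)) :
    tens x 1 * tens 1 y = tens 1 y * tens x 1 := by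
  apply WithConv.ext
  refine TensorProduct.ext' fun c e => ?_
  rw [conv_mul_apply_hitL, conv_mul_apply_hitL, hitL_tens, hitL_tens]
  simp only [tens_apply, hitL_one, LinearMap.convOne_apply, counit_hitL]
  simp

/-- The value of a convolution product at a grouplike element is the product of the values. -/
theorem conv_mul_apply_grouplike {a : C} (ha : IsGroupLikeElem k a)
    (x y : WithConv (C →ₗ[k] k)) : (x * y).ofConv a = x.ofConv a * y.ofConv a := by
  change LinearMap.mul' k k (TensorProduct.map x.ofConv y.ofConv (Coalgebra.comul a)) = _
  simp [ha.comul_eq_tmul_self]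

/-- Evaluation at a grouplike element is multiplicative. -/
def evalGrouplike {a : C} (ha : IsGroupLikeElem k a) : WithConv (C →ₗ[k] k) →* k where
  toFun x := x.ofConv a
  map_one' := by
    change algebraMap k k (Coalgebra.counit (R := k) a) = 1
    simp [ha.counit_eq_one]
  map_mul' := conv_mul_apply_grouplike ha

theorem IsGroupLikeElem.tmul {a : C} {b : E} (ha : IsGroupLikeElem k a)
    (hb : IsGroupLikeElem k b) : IsGroupLikeElem k (a ⊗ₜ[k] b) where
  counit_eq_one := by simp [ha.counit_eq_one, hb.counit_eq_one]
  comul_eq_tmul_self := by simp [ha.comul_eq_tmul_self, hb.comul_eq_tmul_self]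

variable (C) in
/-- The coalgebra map `c ↦ a ⊗ c` for grouplike `a`. -/
def conL {a : E} (ha : IsGroupLikeElem k a) : C →ₗc[k] E ⊗[k] C where
  toLinearMap := TensorProduct.mk k E C a
  counit_comp := by ext; simp [ha.counit_eq_one]
  map_comp_comul := by
    ext c
    simp only [LinearMap.comp_apply, TensorProduct.mk_apply, TensorProduct.comul_tmul,
      ha.comul_eq_tmul_self]
    induction Coalgebra.comul (R := k) c with
    | zero => simp
    | add _ _ h₁ h₂ => simp only [map_add, TensorProduct.tmul_add, h₁, h₂]
    | tmul a b => simp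

@[simp] theorem conL_apply {a : E} (ha : IsGroupLikeElem k a) (c : C) :
    conL C ha c = a ⊗ₜ[k] c := rfl

variable (C) in
/-- The coalgebra map `c ↦ c ⊗ a` for grouplike `a`. -/
def conR {a : E} (ha : IsGroupLikeElem k a) : C →ₗc[k] C ⊗[k] E where
  toLinearMap := (TensorProduct.mk k C E).flip a
  counit_comp := by ext; simp [ha.counit_eq_one]
  map_comp_comul := by
    ext c
    simp only [LinearMap.comp_apply, LinearMap.flip_apply, TensorProduct.mk_apply,
      TensorProduct.comul_tmul, ha.comul_eq_tmul_self]
    induction Coalgebra.comul (R := k) c with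
    | zero => simp
    | add _ _ h₁ h₂ => simp only [map_add, TensorProduct.add_tmul, h₁, h₂]
    | tmul a b => simp

@[simp] theorem conR_apply {a : E} (ha : IsGroupLikeElem k a) (c : C) :
    conR C ha c = c ⊗ₜ[k] a := rfl

/-- The tensor product of two coalgebra maps. -/
abbrev cmap {C' E' : Type*} [AddCommGroup C'] [Module k C'] [Coalgebra k C'] [AddCommGroup E']
    [Module k E'] [Coalgebra k E'] (φ : C →ₗc[k] C') (ψ : E →ₗc[k] E') :
    C ⊗[k] E →ₗc[k] C' ⊗[k] E' := Coalgebra.TensorProduct.map φ ψ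

variable (k C E) in
/-- The coalgebra map `c ⊗ e ↦ c ε(e)`. -/
def prL : C ⊗[k] E →ₗc[k] C :=
  (Coalgebra.TensorProduct.rid k k C).toCoalgHom.comp
    (Coalgebra.TensorProduct.map (CoalgHom.id k C) (Coalgebra.counitCoalgHom k E))

variable (k C E) in
/-- The coalgebra map `c ⊗ e ↦ ε(c) e`. -/
def prR : C ⊗[k] E →ₗc[k] E :=
  (Coalgebra.TensorProduct.lid k E).toCoalgHom.comp
    (Coalgebra.TensorProduct.map (Coalgebra.counitCoalgHom k C) (CoalgHom.id k E))

@[simp] theorem prL_apply (c : C) (e : E) :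
    prL k C E (c ⊗ₜ[k] e) = Coalgebra.counit (R := k) e • c := rfl

@[simp] theorem prR_apply (c : C) (e : E) :
    prR k C E (c ⊗ₜ[k] e) = Coalgebra.counit (R := k) c • e := rfl

theorem toConv_counit :
    (WithConv.toConv Coalgebra.counit : WithConv (C →ₗ[k] k)) = 1 := rfl

theorem pull_prL (x : WithConv (C →ₗ[k] k)) : pull (prL k C E) x = tens x 1 := by
  apply WithConv.ext
  refine TensorProduct.ext' fun c e => ?_
  rw [pull_apply, tens_apply, prL_apply, map_smul, smul_eq_mul, mul_comm]; rfl

theorem pull_prR (y : WithConv (E →ₗ[k] k)) : pull (prR k C E) y = tens 1 y := by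
  apply WithConv.ext
  refine TensorProduct.ext' fun c e => ?_
  rw [pull_apply, tens_apply, prR_apply, map_smul, smul_eq_mul]; rfl

end Convolution

/-! ### Pulling back the reassociator -/

namespace DualQuasiBialgebra

section Pull

variable {k : Type u} {H : Type v} [Field k] [AddCommGroup H] [Module k H] [Coalgebra k H]
variable (D : DualQuasiBialgebra k H)
variable {C : Type*} [AddCommGroup C] [Module k C] [Coalgebra k C]

/-- The functional `ω ∘ F` for a coalgebra map `F`, a unit of the convolution algebra. -/
def w (F : C →ₗc[k] H ⊗[k] (H ⊗[k] H)) : (WithConv (C →ₗ[k] k))ˣ := Units.map (pull F) D.ω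

@[simp] theorem w_apply (F : C →ₗc[k] H ⊗[k] (H ⊗[k] H)) (c : C) :
    (D.w F).val.ofConv c = D.ω.val.ofConv (F c) := rfl

theorem pull_omega (F : C →ₗc[k] H ⊗[k] (H ⊗[k] H)) : pull F D.ω.val = (D.w F).val := rfl

theorem pull_w {E : Type*} [AddCommGroup E] [Module k E] [Coalgebra k E]
    (F : C →ₗc[k] H ⊗[k] (H ⊗[k] H)) (φ : E →ₗc[k] C) :
    pull φ (D.w F).val = (D.w (F.comp φ)).val := rfl

theorem pull_w_inv {E : Type*} [AddCommGroup E] [Module k E] [Coalgebra k E]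
    (F : C →ₗc[k] H ⊗[k] (H ⊗[k] H)) (φ : E →ₗc[k] C) :
    pull φ ((D.w F)⁻¹).val = ((D.w (F.comp φ))⁻¹).val := rfl

/-- The cocycle condition pulled back along a coalgebra map `p : C → H ⊗ H ⊗ H ⊗ H`. -/
theorem cocycle_pull (p : C →ₗc[k] H ⊗[k] (H ⊗[k] (H ⊗[k] H)))
    (F₁ F₂ F₃ F₄ F₅ : C →ₗc[k] H ⊗[k] (H ⊗[k] H))
    (h₁ : F₁.toLinearMap = (TensorProduct.lid k _).toLinearMap ∘ₗ
      LinearMap.rTensor _ Coalgebra.counit ∘ₗ p.toLinearMap)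
    (h₂ : F₂.toLinearMap = LinearMap.lTensor H (LinearMap.rTensor H D.mul.toLinearMap ∘ₗ
      (TensorProduct.assoc k H H H).symm.toLinearMap) ∘ₗ p.toLinearMap)
    (h₃ : F₃.toLinearMap = LinearMap.lTensor H (LinearMap.lTensor H
        ((TensorProduct.rid k H).toLinearMap ∘ₗ LinearMap.lTensor H Coalgebra.counit)) ∘ₗ
      p.toLinearMap)
    (h₄ : F₄.toLinearMap = LinearMap.lTensor H (LinearMap.lTensor H D.mul.toLinearMap) ∘ₗ
      p.toLinearMap)
    (h₅ : F₅.toLinearMap = LinearMap.rTensor (H ⊗[k] H) D.mul.toLinearMap ∘ₗ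
      (TensorProduct.assoc k H H (H ⊗[k] H)).symm.toLinearMap ∘ₗ p.toLinearMap) :
    D.w F₁ * D.w F₂ * D.w F₃ = D.w F₄ * D.w F₅ := by
  apply Units.ext
  have h := congrArg (pull p) D.cocycle
  simp only [map_mul] at h
  have e (F : C →ₗc[k] H ⊗[k] (H ⊗[k] H)) :
      (D.w F).val = WithConv.toConv (D.ω.val.ofConv ∘ₗ F.toLinearMap) := rfl
  simp only [Units.val_mul, e, h₁, h₂, h₃, h₄, h₅]
  refine Eq.trans ?_ h
  congr 2
  apply WithConv.ext
  ext c
  simp only [pull_apply, LinearMap.comp_apply]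
  change _ = (TensorProduct.lid k k) (TensorProduct.map _ _ (p.toLinearMap c))
  induction p.toLinearMap c with
  | zero => simp
  | add _ _ h₁ h₂ => simp only [map_add, h₁, h₂]
  | tmul a b => simp

theorem isGroupLikeElem_one : IsGroupLikeElem k D.one :=
  IsGroupLikeElem.map D.unit (by simp)

theorem isGroupLikeElem_mul {g g' : H} (hg : IsGroupLikeElem k g) (hg' : IsGroupLikeElem k g') :
    IsGroupLikeElem k (D.mul (g ⊗ₜ[k] g')) :=
  (hg.tmul hg').map D.mul

/-- Left multiplication by a grouplike element, a coalgebra map. -/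
def mulL {g : H} (hg : IsGroupLikeElem k g) : H →ₗc[k] H := D.mul.comp (conL H hg)

/-- Right multiplication by a grouplike element, a coalgebra map. -/
def mulR {g : H} (hg : IsGroupLikeElem k g) : H →ₗc[k] H := D.mul.comp (conR H hg)

@[simp] theorem mulL_apply {g : H} (hg : IsGroupLikeElem k g) (h : H) :
    D.mulL hg h = D.mul (g ⊗ₜ[k] h) := rfl

@[simp] theorem mulR_apply {g : H} (hg : IsGroupLikeElem k g) (h : H) :
    D.mulR hg h = D.mul (h ⊗ₜ[k] g) := rfl

variable {D}

theorem comm_hit {g : H} {χ : H →ₗ[k] k} (hD : IsQuasiYDDatum D g χ) (h : H) :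
    D.mul (g ⊗ₜ[k] hitL (WithConv.toConv χ) h) = D.mul (hitR (WithConv.toConv χ) h ⊗ₜ[k] g) :=
  hD.comm h

/-- The commutation rule `g χ(h₁) h₂ = h₁ χ(h₂) g`, tested against functionals. -/
theorem pull_mulR_mul {g : H} {χ : H →ₗ[k] k} (hD : IsQuasiYDDatum D g χ)
    (f : WithConv (H →ₗ[k] k)) :
    pull (D.mulR hD.grouplike) f * WithConv.toConv χ =
      WithConv.toConv χ * pull (D.mulL hD.grouplike) f := by
  apply WithConv.ext
  ext h
  rw [conv_mul_apply_hitR, conv_mul_apply_hitL, pull_apply, pull_apply, mulR_apply, mulL_apply,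
    comm_hit hD]

/-- The commutation rule in the second factor of `C ⊗ H`. -/
theorem pull_map_mulR_mul {g : H} {χ : H →ₗ[k] k} (hD : IsQuasiYDDatum D g χ)
    (f : WithConv (C ⊗[k] H →ₗ[k] k)) :
    pull (cmap (CoalgHom.id k C) (D.mulR hD.grouplike)) f *
        tens 1 (WithConv.toConv χ) =
      tens 1 (WithConv.toConv χ) *
        pull (cmap (CoalgHom.id k C) (D.mulL hD.grouplike)) f := by
  apply WithConv.ext
  refine TensorProduct.ext' fun c h => ?_
  rw [conv_mul_apply_hitR, conv_mul_apply_hitL, pull_apply, pull_apply, hitL_tens, hitR_tens,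
    Coalgebra.TensorProduct.map_tmul, Coalgebra.TensorProduct.map_tmul, mulR_apply, mulL_apply,
    comm_hit hD, hitL_one, hitR_one]

/-- The commutation rule in the first factor of `H ⊗ C`. -/
theorem pull_mulR_map_mul {g : H} {χ : H →ₗ[k] k} (hD : IsQuasiYDDatum D g χ)
    (f : WithConv (H ⊗[k] C →ₗ[k] k)) :
    pull (cmap (D.mulR hD.grouplike) (CoalgHom.id k C)) f *
        tens (WithConv.toConv χ) 1 =
      tens (WithConv.toConv χ) 1 *
        pull (cmap (D.mulL hD.grouplike) (CoalgHom.id k C)) f := by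
  apply WithConv.ext
  refine TensorProduct.ext' fun h c => ?_
  rw [conv_mul_apply_hitR, conv_mul_apply_hitL, pull_apply, pull_apply, hitL_tens, hitR_tens,
    Coalgebra.TensorProduct.map_tmul, Coalgebra.TensorProduct.map_tmul, mulR_apply, mulL_apply,
    comm_hit hD, hitL_one, hitR_one]

end Pull

/-! ### The tensor product of two quasi-Yetter-Drinfeld data -/

section Slots

variable {k : Type u} {H : Type v} [Field k] [AddCommGroup H] [Module k H] [Coalgebra k H]
variable (D : DualQuasiBialgebra k H)

theorem slot₁_omega {a b : H} (ha : IsGroupLikeElem k a) (hb : IsGroupLikeElem k b) :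
    slot₁ D.ω.val a b = (D.w (conR H (ha.tmul hb))).val := rfl

theorem slot₂_omega_inv {a b : H} (ha : IsGroupLikeElem k a) (hb : IsGroupLikeElem k b) :
    slot₂ (D.ω⁻¹).val a b = ((D.w ((conL (H ⊗[k] H) ha).comp (conR H hb)))⁻¹).val := rfl

theorem slot₃_omega {a b : H} (ha : IsGroupLikeElem k a) (hb : IsGroupLikeElem k b) :
    slot₃ D.ω.val a b = (D.w ((conL (H ⊗[k] H) ha).comp (conL H hb))).val := rfl

theorem slot₁₂_omega_inv {a : H} (ha : IsGroupLikeElem k a) :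
    slot₁₂ (D.ω⁻¹).val a =
      ((D.w (cmap (CoalgHom.id k H) (conR H ha)))⁻¹).val := rfl

theorem slot₁₃_omega {a : H} (ha : IsGroupLikeElem k a) :
    slot₁₃ D.ω.val a =
      (D.w (cmap (CoalgHom.id k H) (conL H ha))).val := rfl

theorem slot₂₃_omega_inv {a : H} (ha : IsGroupLikeElem k a) :
    slot₂₃ (D.ω⁻¹).val a = ((D.w (conL (H ⊗[k] H) ha))⁻¹).val := rfl

/-- The character of the tensor product of the one-dimensional modules attached to `(g, χ)` and
`(g', χ')`: `ω(- ⊗ g ⊗ g') * χ * ω⁻¹(g ⊗ - ⊗ g') * χ' * ω(g ⊗ g' ⊗ -)`. -/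
def chiMul (g : H) (χ : WithConv (H →ₗ[k] k)) (g' : H) (χ' : WithConv (H →ₗ[k] k)) :
    WithConv (H →ₗ[k] k) :=
  slot₁ D.ω.val g g' * χ * slot₂ (D.ω⁻¹).val g g' * χ' * slot₃ D.ω.val g g'

end Slots

/-- The rearrangement behind the hexagon for a tensor product of half-braidings.  The
letters `A`, `B`, `C`, `E`, `F`, `G`, with indices, stand for the terms of the six cocycle
identities in which two variables and two grouplike elements are interleaved. -/
theorem hexagon_rearrange {M : Type*} [Monoid M]
    {A₁ A₂ A₃ A₄ A₅ B₁ B₂ B₃ B₄ B₅ C₁ C₂ C₃ C₄ C₅ E₁ E₂ E₃ E₄ E₅ F₁ F₂ F₃ F₄ F₅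
      G₁ G₂ G₃ G₄ G₅ : Mˣ} {X Y X' Y' : M}
    (hA : A₁ * A₂ * A₃ = A₄ * A₅) (hB : B₁ * B₂ * B₃ = B₄ * B₅) (hC : C₁ * C₂ * C₃ = C₄ * C₅)
    (hE : E₁ * E₂ * E₃ = E₄ * E₅) (hF : F₁ * F₂ * F₃ = F₄ * F₅) (hG : G₁ * G₂ * G₃ = G₄ * G₅)
    (h₁ : A₂ * Y = Y * B₂) (h₂ : B₅ * X = X * C₅) (h₃ : B₄ * Y' = Y' * E₄)
    (h₄ : C₄ * Y' = Y' * F₄) (h₅ : X * Y' = Y' * X) (h₆ : E₅ * X = X * F₅)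
    (h₇ : F₂ * X' = X' * G₂) :
    (A₅ : M) * (↑A₃⁻¹ * Y * B₃ * X * ↑C₃⁻¹) * ↑C₂⁻¹ * (↑C₁⁻¹ * Y' * F₁ * X' * ↑G₁⁻¹) * G₄ =
      ↑A₄⁻¹ * (A₁ * Y * ↑B₁⁻¹ * Y' * E₁) * E₂ * (E₃ * X * ↑F₃⁻¹ * X' * G₃) * ↑G₅⁻¹ := by
  have inv {u v : Mˣ} {z : M} (h : (u : M) * z = z * v) : (↑u⁻¹ : M) * z = z * ↑v⁻¹ :=
    ((show SemiconjBy z (v : M) u from h.symm).units_inv_right).symm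
  have s₁ : (A₅ : M) * ↑A₃⁻¹ = ↑A₄⁻¹ * A₁ * A₂ := by
    have : A₅ * A₃⁻¹ = A₄⁻¹ * A₁ * A₂ := by
      rw [mul_inv_eq_iff_eq_mul, mul_assoc, mul_assoc, eq_inv_mul_iff_mul_eq, ← hA, mul_assoc]
    exact_mod_cast congrArg Units.val this
  have s₃ : (B₂ : M) * B₃ = ↑B₁⁻¹ * B₄ * B₅ := by
    have : B₂ * B₃ = B₁⁻¹ * B₄ * B₅ := by
      rw [mul_assoc, eq_inv_mul_iff_mul_eq, ← hB, mul_assoc]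
    exact_mod_cast congrArg Units.val this
  have s₅ : (C₅ : M) * ↑C₃⁻¹ * ↑C₂⁻¹ * ↑C₁⁻¹ = ↑C₄⁻¹ := by
    have : C₅ * C₃⁻¹ * C₂⁻¹ * C₁⁻¹ = C₄⁻¹ := by
      rw [show C₅ * C₃⁻¹ * C₂⁻¹ * C₁⁻¹ = C₅ * (C₁ * C₂ * C₃)⁻¹ by group, hC]; group
    exact_mod_cast congrArg Units.val this
  have s₇ : (E₄ : M) = E₁ * E₂ * E₃ * ↑E₅⁻¹ := by
    exact_mod_cast congrArg Units.val (eq_mul_inv_of_mul_eq hE.symm)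
  have s₉ : (↑F₅⁻¹ : M) * ↑F₄⁻¹ * F₁ = ↑F₃⁻¹ * ↑F₂⁻¹ := by
    have : F₅⁻¹ * F₄⁻¹ * F₁ = F₃⁻¹ * F₂⁻¹ := by
      rw [← mul_inv_rev, ← hF]; group
    exact_mod_cast congrArg Units.val this
  have s₁₁ : (↑G₂⁻¹ : M) * ↑G₁⁻¹ * G₄ = G₃ * ↑G₅⁻¹ := by
    have : G₂⁻¹ * G₁⁻¹ * G₄ = G₃ * G₅⁻¹ := by
      rw [eq_mul_inv_of_mul_eq hG.symm]; group
    exact_mod_cast congrArg Units.val this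
  calc
    _ = (A₅ * ↑A₃⁻¹) * Y * B₃ * X * (↑C₃⁻¹ * ↑C₂⁻¹ * ↑C₁⁻¹) * Y' * F₁ * X' * (↑G₁⁻¹ * G₄) := by
      simp only [mul_assoc]
    _ = ↑A₄⁻¹ * A₁ * (A₂ * Y) * B₃ * X * (↑C₃⁻¹ * ↑C₂⁻¹ * ↑C₁⁻¹) * Y' * F₁ * X' *
        (↑G₁⁻¹ * G₄) := by rw [s₁]; simp only [mul_assoc]
    _ = ↑A₄⁻¹ * A₁ * Y * (B₂ * B₃) * X * (↑C₃⁻¹ * ↑C₂⁻¹ * ↑C₁⁻¹) * Y' * F₁ * X' *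
        (↑G₁⁻¹ * G₄) := by rw [h₁]; simp only [mul_assoc]
    _ = ↑A₄⁻¹ * A₁ * Y * ↑B₁⁻¹ * B₄ * (B₅ * X) * (↑C₃⁻¹ * ↑C₂⁻¹ * ↑C₁⁻¹) * Y' * F₁ * X' *
        (↑G₁⁻¹ * G₄) := by rw [s₃]; simp only [mul_assoc]
    _ = ↑A₄⁻¹ * A₁ * Y * ↑B₁⁻¹ * B₄ * X * (C₅ * ↑C₃⁻¹ * ↑C₂⁻¹ * ↑C₁⁻¹) * Y' * F₁ * X' *
        (↑G₁⁻¹ * G₄) := by rw [h₂]; simp only [mul_assoc]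
    _ = ↑A₄⁻¹ * A₁ * Y * ↑B₁⁻¹ * B₄ * X * (↑C₄⁻¹ * Y') * F₁ * X' * (↑G₁⁻¹ * G₄) := by
      rw [s₅]; simp only [mul_assoc]
    _ = ↑A₄⁻¹ * A₁ * Y * ↑B₁⁻¹ * B₄ * (X * Y') * ↑F₄⁻¹ * F₁ * X' * (↑G₁⁻¹ * G₄) := by
      rw [inv h₄]; simp only [mul_assoc]
    _ = ↑A₄⁻¹ * A₁ * Y * ↑B₁⁻¹ * (B₄ * Y') * X * ↑F₄⁻¹ * F₁ * X' * (↑G₁⁻¹ * G₄) := by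
      rw [h₅]; simp only [mul_assoc]
    _ = ↑A₄⁻¹ * A₁ * Y * ↑B₁⁻¹ * Y' * E₁ * E₂ * E₃ * (↑E₅⁻¹ * X) * ↑F₄⁻¹ * F₁ * X' *
        (↑G₁⁻¹ * G₄) := by rw [h₃, s₇]; simp only [mul_assoc]
    _ = ↑A₄⁻¹ * A₁ * Y * ↑B₁⁻¹ * Y' * E₁ * E₂ * E₃ * X * (↑F₅⁻¹ * ↑F₄⁻¹ * F₁) * X' *
        (↑G₁⁻¹ * G₄) := by rw [inv h₆]; simp only [mul_assoc]
    _ = ↑A₄⁻¹ * A₁ * Y * ↑B₁⁻¹ * Y' * E₁ * E₂ * E₃ * X * ↑F₃⁻¹ * (↑F₂⁻¹ * X') *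
        (↑G₁⁻¹ * G₄) := by rw [s₉]; simp only [mul_assoc]
    _ = ↑A₄⁻¹ * A₁ * Y * ↑B₁⁻¹ * Y' * E₁ * E₂ * E₃ * X * ↑F₃⁻¹ * X' *
        (↑G₂⁻¹ * ↑G₁⁻¹ * G₄) := by rw [inv h₇]; simp only [mul_assoc]
    _ = _ := by rw [s₁₁]; simp only [mul_assoc]

section DatumMul

variable {k : Type u} {H : Type v} [Field k] [AddCommGroup H] [Module k H] [Coalgebra k H]
variable {D : DualQuasiBialgebra k H}

/-- Quasi-associativity of the multiplication, tested against a functional `f` and pulled back along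
a coalgebra map `p : C → H ⊗ H ⊗ H`. -/
theorem quasi_assoc_pull {C : Type*} [AddCommGroup C] [Module k C] [Coalgebra k C]
    (p : C →ₗc[k] H ⊗[k] (H ⊗[k] H)) (P Q : C →ₗc[k] H)
    (hP : P.toLinearMap = D.mul.toLinearMap ∘ₗ LinearMap.lTensor H D.mul.toLinearMap ∘ₗ
      p.toLinearMap)
    (hQ : Q.toLinearMap = D.mul.toLinearMap ∘ₗ LinearMap.rTensor H D.mul.toLinearMap ∘ₗ
      (TensorProduct.assoc k H H H).symm.toLinearMap ∘ₗ p.toLinearMap)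
    (f : WithConv (H →ₗ[k] k)) :
    pull P f * D.w p = D.w p * pull Q f := by
  have key : WithConv.toConv (f.ofConv ∘ₗ D.mul.toLinearMap ∘ₗ
        LinearMap.lTensor H D.mul.toLinearMap) * D.ω.val =
      D.ω.val * WithConv.toConv (f.ofConv ∘ₗ D.mul.toLinearMap ∘ₗ
        LinearMap.rTensor H D.mul.toLinearMap ∘ₗ
        (TensorProduct.assoc k H H H).symm.toLinearMap) := by
    have one_mul (h : H) : D.mul.toLinearMap (D.unit.toLinearMap 1 ⊗ₜ[k] h) = h := D.one_mul' h
    have mul_one (h : H) : D.mul.toLinearMap (h ⊗ₜ[k] D.unit.toLinearMap 1) = h := D.mul_one' h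
    have unit_smul (c : k) : D.unit.toLinearMap c = c • D.unit.toLinearMap 1 := by
      rw [← map_smul, smul_eq_mul, _root_.mul_one]
    apply WithConv.ext
    refine LinearMap.ext fun t => ?_
    have h := congrArg f.ofConv (LinearMap.congr_fun D.quasi_assoc t)
    simp only [LinearMap.comp_apply] at h
    refine Eq.trans ?_ (h.trans ?_)
    · change LinearMap.mul' k k (TensorProduct.map _ _ (Coalgebra.comul t)) = _
      induction Coalgebra.comul (R := k) t with
      | zero => simp
      | add _ _ h₁ h₂ => simp only [map_add, h₁, h₂]
      | tmul a b =>
        simp only [TensorProduct.map_tmul, LinearMap.mul'_apply, LinearMap.comp_apply]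
        rw [unit_smul, TensorProduct.tmul_smul, map_smul, map_smul, mul_one, smul_eq_mul, mul_comm]
    · change _ = LinearMap.mul' k k (TensorProduct.map _ _ (Coalgebra.comul t))
      induction Coalgebra.comul (R := k) t with
      | zero => simp
      | add _ _ h₁ h₂ => simp only [map_add, h₁, h₂]
      | tmul a b =>
        simp only [TensorProduct.map_tmul, LinearMap.mul'_apply, LinearMap.comp_apply]
        rw [unit_smul, ← TensorProduct.smul_tmul', map_smul, map_smul, one_mul, smul_eq_mul]
  have h := congrArg (pull p) key
  rw [map_mul, map_mul] at h
  have eP : pull P f = WithConv.toConv (f.ofConv ∘ₗ P.toLinearMap) := rfl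
  have eQ : pull Q f = WithConv.toConv (f.ofConv ∘ₗ Q.toLinearMap) := rfl
  rw [eP, eQ, hP, hQ]
  exact h

section

variable {g g' : H} {χ χ' : H →ₗ[k] k}

/-- The tensor product of two data satisfies the commutation rule: tested against functionals, the
element `g g'` is moved across the product of characters by using the commutation rules of both
data and quasi-associativity for each of the three reassociators. -/
theorem mul_comm_hit_chiMul (hD : IsQuasiYDDatum D g χ) (hD' : IsQuasiYDDatum D g' χ') (h : H) :
    D.mul (D.mul (g ⊗ₜ[k] g') ⊗ₜ[k]
        hitL (D.chiMul g (WithConv.toConv χ) g' (WithConv.toConv χ')) h) =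
      D.mul (hitR (D.chiMul g (WithConv.toConv χ) g' (WithConv.toConv χ')) h ⊗ₜ[k]
        D.mul (g ⊗ₜ[k] g')) := by
  have hg := hD.grouplike
  have hg' := hD'.grouplike
  have hgg := D.isGroupLikeElem_mul hg hg'
  refine eq_of_functionals (k := k) fun f => ?_
  have q₁ := quasi_assoc_pull (D := D) (conR H (hg.tmul hg')) (D.mulR hgg)
    ((D.mulR hg').comp (D.mulR hg)) rfl rfl (WithConv.toConv f)
  have q₂ := quasi_assoc_pull (D := D) ((conL (H ⊗[k] H) hg).comp (conR H hg'))
    ((D.mulL hg).comp (D.mulR hg')) ((D.mulR hg').comp (D.mulL hg)) rfl rfl (WithConv.toConv f)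
  have q₃ := quasi_assoc_pull (D := D) ((conL (H ⊗[k] H) hg).comp (conL H hg'))
    ((D.mulL hg).comp (D.mulL hg')) (D.mulL hgg) rfl rfl (WithConv.toConv f)
  have q₂' : pull ((D.mulR hg').comp (D.mulL hg)) (WithConv.toConv f) *
      ↑(D.w ((conL (H ⊗[k] H) hg).comp (conR H hg')))⁻¹ =
      ↑(D.w ((conL (H ⊗[k] H) hg).comp (conR H hg')))⁻¹ *
        pull ((D.mulL hg).comp (D.mulR hg')) (WithConv.toConv f) :=
    (SemiconjBy.units_inv_symm_left (a := D.w ((conL (H ⊗[k] H) hg).comp (conR H hg')))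
      q₂.symm).symm
  have c₁ : pull ((D.mulR hg').comp (D.mulR hg)) (WithConv.toConv f) * WithConv.toConv χ =
      WithConv.toConv χ * pull ((D.mulR hg').comp (D.mulL hg)) (WithConv.toConv f) :=
    pull_mulR_mul hD (pull (D.mulR hg') (WithConv.toConv f))
  have c₂ : pull ((D.mulL hg).comp (D.mulR hg')) (WithConv.toConv f) * WithConv.toConv χ' =
      WithConv.toConv χ' * pull ((D.mulL hg).comp (D.mulL hg')) (WithConv.toConv f) :=
    pull_mulR_mul hD' (pull (D.mulL hg) (WithConv.toConv f))
  have key : pull (D.mulR hgg) (WithConv.toConv f) *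
      D.chiMul g (WithConv.toConv χ) g' (WithConv.toConv χ') =
      D.chiMul g (WithConv.toConv χ) g' (WithConv.toConv χ') *
        pull (D.mulL hgg) (WithConv.toConv f) := by
    rw [chiMul, slot₁_omega D hg hg', slot₂_omega_inv D hg hg', slot₃_omega D hg hg']
    simp only [mul_assoc]
    rw [← mul_assoc (pull _ _), q₁, mul_assoc, ← mul_assoc (pull _ _), c₁, mul_assoc,
      ← mul_assoc (pull _ _), q₂', mul_assoc, ← mul_assoc (pull _ _), c₂, mul_assoc, q₃]
  have e : (_ : WithConv (H →ₗ[k] k)).ofConv h = (_ : WithConv (H →ₗ[k] k)).ofConv h :=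
    congrArg (fun z => z.ofConv h) key
  rw [conv_mul_apply_hitR, conv_mul_apply_hitL] at e
  exact e.symm

/-- The character of a tensor product of two data satisfies the multiplicativity axiom.  Once the
two characters are expanded on a product `h l`, what remains are the six instances of the cocycle
condition in which `h`, `l` and `g`, `g'` keep their respective orders. -/
theorem chiMul_mul (hD : IsQuasiYDDatum D g χ) (hD' : IsQuasiYDDatum D g' χ') :
    pull D.mul (D.chiMul g (WithConv.toConv χ) g' (WithConv.toConv χ')) =
      slot₁₂ (D.ω⁻¹).val (D.mul (g ⊗ₜ[k] g')) *
      tens 1 (D.chiMul g (WithConv.toConv χ) g' (WithConv.toConv χ')) *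
      slot₁₃ D.ω.val (D.mul (g ⊗ₜ[k] g')) *
      tens (D.chiMul g (WithConv.toConv χ) g' (WithConv.toConv χ')) 1 *
      slot₂₃ (D.ω⁻¹).val (D.mul (g ⊗ₜ[k] g')) := by
  have hg := hD.grouplike
  have hg' := hD'.grouplike
  have hgg := D.isGroupLikeElem_mul hg hg'
  have m₁ : pull D.mul (WithConv.toConv χ) = slot₁₂ (D.ω⁻¹).val g * tens 1 (WithConv.toConv χ) *
      slot₁₃ D.ω.val g * tens (WithConv.toConv χ) 1 * slot₂₃ (D.ω⁻¹).val g := hD.chi_mul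
  have m₂ : pull D.mul (WithConv.toConv χ') = slot₁₂ (D.ω⁻¹).val g' *
      tens 1 (WithConv.toConv χ') * slot₁₃ D.ω.val g' * tens (WithConv.toConv χ') 1 *
      slot₂₃ (D.ω⁻¹).val g' := hD'.chi_mul
  rw [slot₁₂_omega_inv D hg, slot₁₃_omega D hg, slot₂₃_omega_inv D hg] at m₁
  rw [slot₁₂_omega_inv D hg', slot₁₃_omega D hg', slot₂₃_omega_inv D hg'] at m₂
  rw [slot₁₂_omega_inv D hgg, slot₁₃_omega D hgg, slot₂₃_omega_inv D hgg, ← pull_prR, ← pull_prL,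
    chiMul, slot₁_omega D hg hg', slot₂_omega_inv D hg hg', slot₃_omega D hg hg']
  simp only [map_mul]
  rw [m₁, m₂, pull_prR (WithConv.toConv χ), pull_prR (WithConv.toConv χ'),
    pull_prL (WithConv.toConv χ), pull_prL (WithConv.toConv χ')]
  have cg := hg.counit_eq_one
  have cg' := hg'.counit_eq_one
  -- the cocycle condition at `(h, l, g, g')`
  have hA := D.cocycle_pull (cmap (CoalgHom.id k H) (conR H (hg.tmul hg')))
    ((conR H (hg.tmul hg')).comp (prR k H H))
    ((cmap (CoalgHom.id k H) (conR H hg')).comp (cmap (CoalgHom.id k H) (D.mulR hg)))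
    (cmap (CoalgHom.id k H) (conR H hg)) (cmap (CoalgHom.id k H) (conR H hgg))
    ((conR H (hg.tmul hg')).comp D.mul)
    (by ext; simp) (by ext; simp) (by ext; simp [cg']) (by ext; simp)
    (by ext; simp)
  -- at `(h, g, l, g')`
  have hB := D.cocycle_pull (cmap (CoalgHom.id k H) ((conL (H ⊗[k] H) hg).comp (conR H hg')))
    (((conL (H ⊗[k] H) hg).comp (conR H hg')).comp (prR k H H))
    ((cmap (CoalgHom.id k H) (conR H hg')).comp (cmap (CoalgHom.id k H) (D.mulL hg)))
    (cmap (CoalgHom.id k H) (conL H hg))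
    ((cmap (CoalgHom.id k H) (conL H hg)).comp (cmap (CoalgHom.id k H) (D.mulR hg')))
    ((cmap (CoalgHom.id k H) (conR H hg')).comp (cmap (D.mulR hg) (CoalgHom.id k H)))
    (by ext; simp) (by ext; simp) (by ext; simp [cg']) (by ext; simp)
    (by ext; simp)
  -- at `(g, h, l, g')`
  have hC := D.cocycle_pull ((conL _ hg).comp (cmap (CoalgHom.id k H) (conR H hg')))
    (cmap (CoalgHom.id k H) (conR H hg')) (((conL (H ⊗[k] H) hg).comp (conR H hg')).comp D.mul)
    (conL (H ⊗[k] H) hg) ((conL (H ⊗[k] H) hg).comp (cmap (CoalgHom.id k H) (D.mulR hg')))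
    ((cmap (CoalgHom.id k H) (conR H hg')).comp (cmap (D.mulL hg) (CoalgHom.id k H)))
    (by ext; simp [cg]) (by ext; simp) (by ext; simp [cg']) (by ext; simp)
    (by ext; simp)
  -- at `(h, g, g', l)`
  have hE := D.cocycle_pull (cmap (CoalgHom.id k H) ((conL (H ⊗[k] H) hg).comp (conL H hg')))
    (((conL (H ⊗[k] H) hg).comp (conL H hg')).comp (prR k H H))
    (cmap (CoalgHom.id k H) (conL H hgg)) ((conR H (hg.tmul hg')).comp (prL k H H))
    ((cmap (CoalgHom.id k H) (conL H hg)).comp (cmap (CoalgHom.id k H) (D.mulL hg')))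
    ((cmap (CoalgHom.id k H) (conL H hg')).comp (cmap (D.mulR hg) (CoalgHom.id k H)))
    (by ext; simp) (by ext; simp) (by ext; simp) (by ext; simp)
    (by ext; simp)
  -- at `(g, h, g', l)`
  have hF := D.cocycle_pull ((conL _ hg).comp (cmap (CoalgHom.id k H) (conL H hg')))
    (cmap (CoalgHom.id k H) (conL H hg'))
    ((conL (H ⊗[k] H) hg).comp (cmap (D.mulR hg') (CoalgHom.id k H)))
    (((conL (H ⊗[k] H) hg).comp (conR H hg')).comp (prL k H H))
    ((conL (H ⊗[k] H) hg).comp (cmap (CoalgHom.id k H) (D.mulL hg')))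
    ((cmap (CoalgHom.id k H) (conL H hg')).comp (cmap (D.mulL hg) (CoalgHom.id k H)))
    (by ext; simp [cg]) (by ext; simp) (by ext; simp) (by ext; simp)
    (by ext; simp)
  -- at `(g, g', h, l)`
  have hG := D.cocycle_pull ((conL _ hg).comp (conL (H ⊗[k] H) hg'))
    (conL (H ⊗[k] H) hg') ((conL (H ⊗[k] H) hg).comp (cmap (D.mulL hg') (CoalgHom.id k H)))
    (((conL (H ⊗[k] H) hg).comp (conL H hg')).comp (prL k H H))
    (((conL (H ⊗[k] H) hg).comp (conL H hg')).comp D.mul) (conL (H ⊗[k] H) hgg)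
    (by ext; simp [cg]) (by ext; simp) (by ext; simp) (by ext; simp)
    (by ext; simp)
  have h₁ := pull_map_mulR_mul hD (pull (cmap (CoalgHom.id k H) (conR H hg')) D.ω.val)
  have h₂ := pull_mulR_map_mul hD (pull (cmap (CoalgHom.id k H) (conR H hg')) D.ω.val)
  have h₃ := pull_map_mulR_mul hD' (pull (cmap (CoalgHom.id k H) (conL H hg)) D.ω.val)
  have h₄ := pull_map_mulR_mul hD' (pull (conL (H ⊗[k] H) hg) D.ω.val)
  have h₆ := pull_mulR_map_mul hD (pull (cmap (CoalgHom.id k H) (conL H hg')) D.ω.val)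
  have h₇ := pull_mulR_map_mul hD' (pull (conL (H ⊗[k] H) hg) D.ω.val)
  simp only [pull_omega, pull_w] at h₁ h₂ h₃ h₄ h₆ h₇
  simp only [pull_w, pull_w_inv]
  exact hexagon_rearrange hA hB hC hE hF hG h₁ h₂ h₃ h₄ (tens_one_mul_one_tens _ _) h₆ h₇

end

end DatumMul
section DatumMonoid

variable {k : Type u} {H : Type v} [Field k] [AddCommGroup H] [Module k H] [Coalgebra k H]
variable (D : DualQuasiBialgebra k H)

theorem one_mul_apply (h : H) : D.mul (D.one ⊗ₜ[k] h) = h := D.one_mul' h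

theorem mul_one_apply (h : H) : D.mul (h ⊗ₜ[k] D.one) = h := D.mul_one' h

theorem w_eq_one_of_one_right {C : Type*} [AddCommGroup C] [Module k C] [Coalgebra k C]
    (φ : C →ₗc[k] H ⊗[k] H) :
    D.w ((cmap (CoalgHom.id k H) (conR H D.isGroupLikeElem_one)).comp φ) = 1 := by
  have : D.w (cmap (CoalgHom.id k H) (conR H D.isGroupLikeElem_one)) = 1 := by
    apply Units.ext
    apply WithConv.ext
    refine TensorProduct.ext' fun h l => ?_
    refine (D.normal_right h l).trans ?_
    simp [mul_comm]
  apply Units.ext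
  rw [← pull_w, this, Units.val_one, map_one, Units.val_one]

theorem w_eq_one_of_one_mid {C : Type*} [AddCommGroup C] [Module k C] [Coalgebra k C]
    (φ : C →ₗc[k] H ⊗[k] H) :
    D.w ((cmap (CoalgHom.id k H) (conL H D.isGroupLikeElem_one)).comp φ) = 1 := by
  have : D.w (cmap (CoalgHom.id k H) (conL H D.isGroupLikeElem_one)) = 1 := by
    apply Units.ext
    apply WithConv.ext
    refine TensorProduct.ext' fun h l => ?_
    refine (D.normal_mid h l).trans ?_
    simp [mul_comm]
  apply Units.ext
  rw [← pull_w, this, Units.val_one, map_one, Units.val_one]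

theorem w_eq_one_of_one_left {C : Type*} [AddCommGroup C] [Module k C] [Coalgebra k C]
    (φ : C →ₗc[k] H ⊗[k] H) :
    D.w ((conL (H ⊗[k] H) D.isGroupLikeElem_one).comp φ) = 1 := by
  have : D.w (conL (H ⊗[k] H) D.isGroupLikeElem_one) = 1 := by
    apply Units.ext
    apply WithConv.ext
    refine TensorProduct.ext' fun h l => ?_
    refine (D.normal_left h l).trans ?_
    simp [mul_comm]
  apply Units.ext
  rw [← pull_w, this, Units.val_one, map_one, Units.val_one]

theorem om_one_left {a b : H} (ha : IsGroupLikeElem k a) (hb : IsGroupLikeElem k b) :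
    D.om D.one a b = 1 := by
  refine (D.normal_left a b).trans ?_
  simp [ha.counit_eq_one, hb.counit_eq_one]

theorem om_one_mid {a b : H} (ha : IsGroupLikeElem k a) (hb : IsGroupLikeElem k b) :
    D.om a D.one b = 1 := by
  refine (D.normal_mid a b).trans ?_
  simp [ha.counit_eq_one, hb.counit_eq_one]

theorem om_one_right {a b : H} (ha : IsGroupLikeElem k a) (hb : IsGroupLikeElem k b) :
    D.om a b D.one = 1 := by
  refine (D.normal_right a b).trans ?_
  simp [ha.counit_eq_one, hb.counit_eq_one]

theorem om_mul_omInv {a b c : H} (ha : IsGroupLikeElem k a) (hb : IsGroupLikeElem k b)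
    (hc : IsGroupLikeElem k c) : D.om a b c * D.omInv a b c = 1 := by
  have h := congrArg (evalGrouplike (ha.tmul (hb.tmul hc))) D.ω.mul_inv
  rw [map_mul, map_one] at h
  exact h

theorem omInv_eq_inv {a b c : H} (ha : IsGroupLikeElem k a) (hb : IsGroupLikeElem k b)
    (hc : IsGroupLikeElem k c) : D.omInv a b c = (D.om a b c)⁻¹ :=
  eq_inv_of_mul_eq_one_right (D.om_mul_omInv ha hb hc)

theorem om_ne_zero {a b c : H} (ha : IsGroupLikeElem k a) (hb : IsGroupLikeElem k b)
    (hc : IsGroupLikeElem k c) : D.om a b c ≠ 0 :=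
  left_ne_zero_of_mul_eq_one (D.om_mul_omInv ha hb hc)

theorem om_cocycle {a b c d : H} (ha : IsGroupLikeElem k a) (hb : IsGroupLikeElem k b)
    (hc : IsGroupLikeElem k c) (hd : IsGroupLikeElem k d) :
    D.om b c d * D.om a (D.mul (b ⊗ₜ[k] c)) d * D.om a b c =
      D.om a b (D.mul (c ⊗ₜ[k] d)) * D.om (D.mul (a ⊗ₜ[k] b)) c d := by
  have h := congrArg (evalGrouplike (ha.tmul (hb.tmul (hc.tmul hd)))) D.cocycle
  simp only [map_mul] at h
  simpa [evalGrouplike, om, ha.counit_eq_one, hd.counit_eq_one] using h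

/-- Grouplike elements associate. -/
theorem mul_assoc_grouplike {a b c : H} (ha : IsGroupLikeElem k a) (hb : IsGroupLikeElem k b)
    (hc : IsGroupLikeElem k c) :
    D.mul (D.mul (a ⊗ₜ[k] b) ⊗ₜ[k] c) = D.mul (a ⊗ₜ[k] D.mul (b ⊗ₜ[k] c)) := by
  refine eq_of_functionals (k := k) fun f => ?_
  have h := congrArg (evalGrouplike ha) (quasi_assoc_pull (D := D) (conR H (hb.tmul hc))
    (D.mulR (D.isGroupLikeElem_mul hb hc)) ((D.mulR hc).comp (D.mulR hb)) rfl rfl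
    (WithConv.toConv f))
  rw [map_mul, map_mul, mul_comm] at h
  exact (mul_left_cancel₀ (D.om_ne_zero ha hb hc) h).symm

variable {D}

theorem chiMul_apply_grouplike {g g' h : H} (hg : IsGroupLikeElem k g)
    (hg' : IsGroupLikeElem k g') (hh : IsGroupLikeElem k h) (χ χ' : WithConv (H →ₗ[k] k)) :
    (D.chiMul g χ g' χ').ofConv h =
      D.om h g g' * χ.ofConv h * (D.om g h g')⁻¹ * χ'.ofConv h * D.om g g' h := by
  rw [chiMul]
  simp only [conv_mul_apply_grouplike hh]
  rw [← omInv_eq_inv D hg hh hg']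
  rfl

/-- The datum of the unit object. -/
theorem isQuasiYDDatum_one : IsQuasiYDDatum D D.one Coalgebra.counit where
  grouplike := D.isGroupLikeElem_one
  unitary := D.isGroupLikeElem_one.counit_eq_one
  chi_mul := by
    have h₁ := D.w_eq_one_of_one_right (CoalgHom.id k _)
    have h₂ := D.w_eq_one_of_one_mid (CoalgHom.id k _)
    have h₃ := D.w_eq_one_of_one_left (CoalgHom.id k _)
    rw [CoalgHom.comp_id] at h₁ h₂ h₃
    rw [slot₁₂_omega_inv D D.isGroupLikeElem_one, slot₁₃_omega D D.isGroupLikeElem_one,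
      slot₂₃_omega_inv D D.isGroupLikeElem_one, h₁, h₂, h₃]
    have t : (WithConv.toConv ((TensorProduct.lid k k).toLinearMap ∘ₗ
        TensorProduct.map Coalgebra.counit Coalgebra.counit) :
          WithConv (H ⊗[k] H →ₗ[k] k)) = 1 := by
      apply WithConv.ext
      refine TensorProduct.ext' fun h l => ?_
      simp [LinearMap.convOne_def, mul_comm]
    rw [t, inv_one, Units.val_one]
    simp only [one_mul]
    exact map_one (pull D.mul)
  comm h := by
    change D.mul (_ ⊗ₜ[k] hitL (WithConv.toConv Coalgebra.counit) h) =
      D.mul (hitR (WithConv.toConv Coalgebra.counit) h ⊗ₜ[k] _)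
    rw [toConv_counit, hitL_one, hitR_one, one_mul_apply, mul_one_apply]

/-- The tensor product of the one-dimensional modules of two data comes from a datum. -/
theorem _root_.IsQuasiYDDatum.chiMul {g g' : H} {χ χ' : H →ₗ[k] k} (hD : IsQuasiYDDatum D g χ)
    (hD' : IsQuasiYDDatum D g' χ') :
    IsQuasiYDDatum D (D.mul (g ⊗ₜ[k] g'))
      (D.chiMul g (WithConv.toConv χ) g' (WithConv.toConv χ')).ofConv where
  grouplike := D.isGroupLikeElem_mul hD.grouplike hD'.grouplike
  unitary := by
    rw [chiMul_apply_grouplike hD.grouplike hD'.grouplike D.isGroupLikeElem_one,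
      om_one_left D hD.grouplike hD'.grouplike, om_one_mid D hD.grouplike hD'.grouplike,
      om_one_right D hD.grouplike hD'.grouplike]
    simp [hD.unitary, hD'.unitary]
  chi_mul := chiMul_mul hD hD'
  comm h := mul_comm_hit_chiMul hD hD' h

variable (D) in
/-- A quasi-Yetter-Drinfeld datum for `D`, bundled. -/
@[ext]
structure YDDatum where
  /-- The grouplike element. -/
  g : H
  /-- The character. -/
  χ : H →ₗ[k] k
  isDatum : IsQuasiYDDatum D g χ

/-- In the convolution algebra, the two bracketings of a threefold tensor product of
half-braidings agree up to the scalar by which the associativity constraint acts, which cancels.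
The letters with indices stand for the terms of the cocycle identities in which one variable and
three grouplike elements are interleaved; `s` is a central unit. -/
theorem half_braiding_rearrange {M : Type*} [Monoid M]
    {A₂ A₃ A₄ A₅ B₁ B₂ B₃ B₄ B₅ C₁ C₂ C₃ C₄ C₅ E₁ E₂ E₄ E₅ s : Mˣ} {X X' X'' : M}
    (hs : ∀ z : M, (s : M) * z = z * s)
    (hA : s * A₂ * A₃ = A₄ * A₅) (hB : B₁ * B₂ * B₃ = B₄ * B₅) (hC : C₁ * C₂ * C₃ = C₄ * C₅)
    (hE : E₁ * E₂ * s = E₄ * E₅)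
    (h₁ : A₅ * X = X * B₅) (h₂ : B₂ * X' = X' * C₂) (h₃ : C₄ * X'' = X'' * E₄) :
    (A₂ : M) * (A₃ * X * ↑B₃⁻¹ * X' * C₃) * ↑C₅⁻¹ * X'' * E₅ =
      A₄ * X * ↑B₄⁻¹ * (B₁ * X' * ↑C₁⁻¹ * X'' * E₁) * E₂ := by
  have inv {u v : Mˣ} {z : M} (h : (u : M) * z = z * v) : (↑u⁻¹ : M) * z = z * ↑v⁻¹ :=
    ((show SemiconjBy z (v : M) u from h.symm).units_inv_right).symm
  have s₂ : (B₅ : M) * ↑B₃⁻¹ = ↑B₄⁻¹ * B₁ * B₂ := by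
    have : B₅ * B₃⁻¹ = B₄⁻¹ * B₁ * B₂ := by
      rw [mul_inv_eq_iff_eq_mul, mul_assoc, mul_assoc, eq_inv_mul_iff_mul_eq, ← hB, mul_assoc]
    exact_mod_cast congrArg Units.val this
  have s₃ : (C₂ : M) * C₃ * ↑C₅⁻¹ = ↑C₁⁻¹ * C₄ := by
    have : C₂ * C₃ * C₅⁻¹ = C₁⁻¹ * C₄ := by
      rw [mul_inv_eq_iff_eq_mul, mul_assoc, eq_inv_mul_iff_mul_eq, ← hC, mul_assoc]
    exact_mod_cast congrArg Units.val this
  have hA' : (s : M) * A₂ * A₃ = A₄ * A₅ := by exact_mod_cast congrArg Units.val hA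
  have hE' : (E₁ : M) * E₂ * s = E₄ * E₅ := by exact_mod_cast congrArg Units.val hE
  rw [← Units.mul_right_inj s]
  calc
    _ = (s * A₂ * A₃) * X * ↑B₃⁻¹ * X' * C₃ * ↑C₅⁻¹ * X'' * E₅ := by simp only [mul_assoc]
    _ = A₄ * (A₅ * X) * ↑B₃⁻¹ * X' * C₃ * ↑C₅⁻¹ * X'' * E₅ := by
      rw [hA']; simp only [mul_assoc]
    _ = A₄ * X * (B₅ * ↑B₃⁻¹) * X' * C₃ * ↑C₅⁻¹ * X'' * E₅ := by
      rw [h₁]; simp only [mul_assoc]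
    _ = A₄ * X * ↑B₄⁻¹ * B₁ * (B₂ * X') * C₃ * ↑C₅⁻¹ * X'' * E₅ := by
      rw [s₂]; simp only [mul_assoc]
    _ = A₄ * X * ↑B₄⁻¹ * B₁ * X' * (C₂ * C₃ * ↑C₅⁻¹) * X'' * E₅ := by
      rw [h₂]; simp only [mul_assoc]
    _ = A₄ * X * ↑B₄⁻¹ * B₁ * X' * ↑C₁⁻¹ * (C₄ * X'') * E₅ := by
      rw [s₃]; simp only [mul_assoc]
    _ = A₄ * X * ↑B₄⁻¹ * B₁ * X' * ↑C₁⁻¹ * X'' * (E₄ * E₅) := by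
      rw [h₃]; simp only [mul_assoc]
    _ = (A₄ * X * ↑B₄⁻¹ * (B₁ * X' * ↑C₁⁻¹ * X'' * E₁) * E₂) * s := by
      rw [← hE']; simp only [mul_assoc]
    _ = _ := (hs _).symm

/-- Tensor products of characters are strictly associative: the associativity constraint of
one-dimensional modules is a scalar, and an isomorphism that is a scalar forces equality. -/
theorem chiMul_assoc {g g' g'' : H} {χ χ' χ'' : H →ₗ[k] k} (hD : IsQuasiYDDatum D g χ)
    (hD' : IsQuasiYDDatum D g' χ') (hD'' : IsQuasiYDDatum D g'' χ'') :
    D.chiMul (D.mul (g ⊗ₜ[k] g')) (D.chiMul g (WithConv.toConv χ) g' (WithConv.toConv χ'))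
        g'' (WithConv.toConv χ'') =
      D.chiMul g (WithConv.toConv χ) (D.mul (g' ⊗ₜ[k] g''))
        (D.chiMul g' (WithConv.toConv χ') g'' (WithConv.toConv χ'')) := by
  have hg := hD.grouplike
  have hg' := hD'.grouplike
  have hg'' := hD''.grouplike
  have h₁₂ := D.isGroupLikeElem_mul hg hg'
  have h₂₃ := D.isGroupLikeElem_mul hg' hg''
  have cg := hg.counit_eq_one
  have cg' := hg'.counit_eq_one
  have cg'' := hg''.counit_eq_one
  -- the scalar `ω(g ⊗ g' ⊗ g'')`, as the functional `h ↦ ε(h) ω(g ⊗ g' ⊗ g'')`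
  let S := (prR k H (H ⊗[k] (H ⊗[k] H))).comp (conR H (hg.tmul (hg'.tmul hg'')))
  have hs (z : WithConv (H →ₗ[k] k)) : (D.w S).val * z = z * (D.w S).val := by
    have : (D.w S).val = D.om g g' g'' • 1 := by
      apply WithConv.ext
      ext h
      simp [S, om, mul_comm]
    rw [this, smul_mul_assoc, one_mul, mul_smul_comm, mul_one]
  have hA := D.cocycle_pull (conR H (hg.tmul (hg'.tmul hg''))) S (conR H (h₁₂.tmul hg''))
    (conR H (hg.tmul hg')) (conR H (hg.tmul h₂₃)) ((conR H (hg'.tmul hg'')).comp (D.mulR hg))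
    (by ext; simp [S]) (by ext; simp) (by ext; simp [cg'']) (by ext; simp) (by ext; simp)
  have hB := D.cocycle_pull ((conL _ hg).comp (conR H (hg'.tmul hg''))) (conR H (hg'.tmul hg''))
    (((conL (H ⊗[k] H) hg).comp (conR H hg'')).comp (D.mulR hg'))
    ((conL (H ⊗[k] H) hg).comp (conR H hg')) ((conL (H ⊗[k] H) hg).comp (conR H h₂₃))
    ((conR H (hg'.tmul hg'')).comp (D.mulL hg))
    (by ext; simp [cg]) (by ext; simp) (by ext; simp [cg'']) (by ext; simp) (by ext; simp)
  have hC := D.cocycle_pull ((conL _ hg).comp ((conL (H ⊗[k] H) hg').comp (conR H hg'')))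
    ((conL (H ⊗[k] H) hg').comp (conR H hg''))
    (((conL (H ⊗[k] H) hg).comp (conR H hg'')).comp (D.mulL hg'))
    ((conL (H ⊗[k] H) hg).comp (conL H hg'))
    (((conL (H ⊗[k] H) hg).comp (conL H hg')).comp (D.mulR hg''))
    ((conL (H ⊗[k] H) h₁₂).comp (conR H hg''))
    (by ext; simp [cg]) (by ext; simp) (by ext; simp [cg'']) (by ext; simp) (by ext; simp)
  have hE := D.cocycle_pull ((conL _ hg).comp ((conL (H ⊗[k] H) hg').comp (conL H hg'')))
    ((conL (H ⊗[k] H) hg').comp (conL H hg''))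
    ((conL (H ⊗[k] H) hg).comp (conL H h₂₃)) S
    (((conL (H ⊗[k] H) hg).comp (conL H hg')).comp (D.mulL hg''))
    ((conL (H ⊗[k] H) h₁₂).comp (conL H hg''))
    (by ext; simp [cg]) (by ext; simp) (by ext; simp [S]) (by ext; simp) (by ext; simp)
  have c₁ := pull_mulR_mul hD (pull (conR H (hg'.tmul hg'')) D.ω.val)
  have c₂ := pull_mulR_mul hD' (pull ((conL (H ⊗[k] H) hg).comp (conR H hg'')) D.ω.val)
  have c₃ := pull_mulR_mul hD'' (pull ((conL (H ⊗[k] H) hg).comp (conL H hg')) D.ω.val)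
  simp only [pull_omega, pull_w] at c₁ c₂ c₃
  simp only [DualQuasiBialgebra.chiMul]
  rw [slot₁_omega D h₁₂ hg'', slot₂_omega_inv D h₁₂ hg'', slot₃_omega D h₁₂ hg'',
    slot₁_omega D hg hg', slot₂_omega_inv D hg hg', slot₃_omega D hg hg',
    slot₁_omega D hg h₂₃, slot₂_omega_inv D hg h₂₃, slot₃_omega D hg h₂₃,
    slot₁_omega D hg' hg'', slot₂_omega_inv D hg' hg'', slot₃_omega D hg' hg'']
  exact half_braiding_rearrange hs hA hB hC hE c₁ c₂ c₃

theorem one_chiMul {g : H} (hg : IsGroupLikeElem k g) (χ : WithConv (H →ₗ[k] k)) :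
    D.chiMul D.one (WithConv.toConv Coalgebra.counit) g χ = χ := by
  have e₁ : slot₁ D.ω.val D.one g =
    (D.w ((cmap (CoalgHom.id k H) (conL H D.isGroupLikeElem_one)).comp (conR H hg))).val := rfl
  rw [DualQuasiBialgebra.chiMul, e₁, slot₂_omega_inv D D.isGroupLikeElem_one hg,
    slot₃_omega D D.isGroupLikeElem_one hg, w_eq_one_of_one_left, w_eq_one_of_one_left,
    w_eq_one_of_one_mid, toConv_counit]
  simp

theorem chiMul_one {g : H} (hg : IsGroupLikeElem k g) (χ : WithConv (H →ₗ[k] k)) :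
    D.chiMul g χ D.one (WithConv.toConv Coalgebra.counit) = χ := by
  have e₁ : slot₁ D.ω.val g D.one =
    (D.w ((cmap (CoalgHom.id k H) (conR H D.isGroupLikeElem_one)).comp (conR H hg))).val := rfl
  have e₂ : slot₂ (D.ω⁻¹).val g D.one =
    ((D.w ((cmap (CoalgHom.id k H) (conR H D.isGroupLikeElem_one)).comp (conL H hg)))⁻¹).val := rfl
  have e₃ : slot₃ D.ω.val g D.one =
    (D.w ((cmap (CoalgHom.id k H) (conL H D.isGroupLikeElem_one)).comp (conL H hg))).val := rfl
  rw [DualQuasiBialgebra.chiMul, e₁, e₂, e₃, w_eq_one_of_one_right, w_eq_one_of_one_right,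
    w_eq_one_of_one_mid, toConv_counit]
  simp

namespace YDDatum

/-- The multiplication is that of the corresponding one-dimensional modules under the tensor
product; its associativity and unit laws hold on the nose. -/
instance : Monoid (YDDatum D) where
  mul d e := ⟨_, _, d.isDatum.chiMul e.isDatum⟩
  one := ⟨_, _, isQuasiYDDatum_one⟩
  mul_assoc d e f := YDDatum.ext
    (D.mul_assoc_grouplike d.isDatum.grouplike e.isDatum.grouplike f.isDatum.grouplike)
    (congrArg WithConv.ofConv (chiMul_assoc d.isDatum e.isDatum f.isDatum))
  one_mul d := YDDatum.ext (D.one_mul_apply d.g)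
    (congrArg WithConv.ofConv (one_chiMul d.isDatum.grouplike _))
  mul_one d := YDDatum.ext (D.mul_one_apply d.g)
    (congrArg WithConv.ofConv (chiMul_one d.isDatum.grouplike _))

@[simp] theorem one_g : (1 : YDDatum D).g = D.one := rfl

@[simp] theorem one_chi : (1 : YDDatum D).χ = Coalgebra.counit := rfl

@[simp] theorem mul_g (d e : YDDatum D) : (d * e).g = D.mul (d.g ⊗ₜ[k] e.g) := rfl

@[simp] theorem mul_chi (d e : YDDatum D) : (d * e).χ =
    (D.chiMul d.g (WithConv.toConv d.χ) e.g (WithConv.toConv e.χ)).ofConv := rfl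

theorem grouplike (d : YDDatum D) : IsGroupLikeElem k d.g := d.isDatum.grouplike

theorem pow_g (d : YDDatum D) (n : ℕ) : (d ^ n).g = D.pow d.g n := by
  induction n with
  | zero => rw [_root_.pow_zero]; rfl
  | succ n ih => rw [pow_succ', mul_g, ih]; rfl

theorem pow_chi (d : YDDatum D) (n : ℕ) : (d ^ n).χ = (D.chiPow d.g d.χ n).ofConv := by
  induction n with
  | zero => rw [_root_.pow_zero]; rfl
  | succ n ih => rw [pow_succ', mul_chi, ih, pow_g]; rfl

end YDDatum

end DatumMonoid
end DualQuasiBialgebra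

/-! ### Homogeneous elements of Yetter-Drinfeld modules -/

namespace DualQuasiBialgebra

theorem twist_tmul {k : Type*} {H : Type*} [Field k] [AddCommGroup H] [Module k H]
    {U V W : Type*} [AddCommGroup U] [Module k U] [AddCommGroup V] [Module k V]
    [AddCommGroup W] [Module k W] {ρU : U →ₗ[k] H ⊗[k] U} {ρV : V →ₗ[k] H ⊗[k] V}
    {ρW : W →ₗ[k] H ⊗[k] W} (f : WithConv (H ⊗[k] (H ⊗[k] H) →ₗ[k] k)) {a b c : H}
    {u : U} {v : V} {w : W} (hu : ρU u = a ⊗ₜ[k] u) (hv : ρV v = b ⊗ₜ[k] v)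
    (hw : ρW w = c ⊗ₜ[k] w) :
    twist f ρU ρV ρW (u ⊗ₜ[k] (v ⊗ₜ[k] w)) =
      f.ofConv (a ⊗ₜ[k] (b ⊗ₜ[k] c)) • (u ⊗ₜ[k] (v ⊗ₜ[k] w)) := by
  simp [twist, hu, hv, hw]

section Homog

variable {k : Type u} {H : Type v} [Field k] [AddCommGroup H] [Module k H] [Coalgebra k H]
variable {D : DualQuasiBialgebra k H}

/-- An element on which `H` coacts through the grouplike element, and acts through the character,
of the datum `d`. -/
structure IsHomog (V : ActCoact k H) (d : YDDatum D) (x : V) : Prop where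
  coact : V.coact x = d.g ⊗ₜ[k] x
  act : ∀ h : H, V.act (h ⊗ₜ[k] x) = d.χ h • x

section Twist

variable {U V W : Type*} [AddCommGroup U] [Module k U] [AddCommGroup V] [Module k V]
  [AddCommGroup W] [Module k W] {ρU : U →ₗ[k] H ⊗[k] U} {ρV : V →ₗ[k] H ⊗[k] V}
  {ρW : W →ₗ[k] H ⊗[k] W} (f : WithConv (H ⊗[k] (H ⊗[k] H) →ₗ[k] k)) {a b c : H}
  {u : U} {v : V} {w : W}

/-!
The twist `f(u₋₁ ⊗ v₋₁ ⊗ w₋₁) u₀ ⊗ v₀ ⊗ w₀` when one or two of the three comodules are `H` itself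
and the elements of the others are homogeneous: `f`, with the homogeneous degrees filled in, acts
on the entries in `H` by `hitL`.
-/

theorem twist_comul_left (hv : ρV v = b ⊗ₜ[k] v) (hw : ρW w = c ⊗ₜ[k] w) (h : H) :
    twist f Coalgebra.comul ρV ρW (h ⊗ₜ[k] (v ⊗ₜ[k] w)) =
      hitL (slot₁ f b c) h ⊗ₜ[k] (v ⊗ₜ[k] w) := by
  simp only [twist, hitL, LinearMap.comp_apply, TensorProduct.map_tmul, hv, hw]
  induction Coalgebra.comul (R := k) h with
  | zero => simp
  | add _ _ h₁ h₂ => simp only [map_add, TensorProduct.add_tmul, h₁, h₂]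
  | tmul x y => simp [slot₁, TensorProduct.smul_tmul']

theorem twist_comul_mid (hu : ρU u = a ⊗ₜ[k] u) (hw : ρW w = c ⊗ₜ[k] w) (h : H) :
    twist f ρU Coalgebra.comul ρW (u ⊗ₜ[k] (h ⊗ₜ[k] w)) =
      u ⊗ₜ[k] (hitL (slot₂ f a c) h ⊗ₜ[k] w) := by
  simp only [twist, hitL, LinearMap.comp_apply, TensorProduct.map_tmul, hu, hw]
  induction Coalgebra.comul (R := k) h with
  | zero => simp
  | add _ _ h₁ h₂ =>
    simp only [map_add, TensorProduct.add_tmul, TensorProduct.tmul_add, h₁, h₂]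
  | tmul x y => simp [slot₂, ← TensorProduct.smul_tmul']

theorem twist_comul_right (hu : ρU u = a ⊗ₜ[k] u) (hv : ρV v = b ⊗ₜ[k] v) (h : H) :
    twist f ρU ρV Coalgebra.comul (u ⊗ₜ[k] (v ⊗ₜ[k] h)) =
      u ⊗ₜ[k] (v ⊗ₜ[k] hitL (slot₃ f a b) h) := by
  simp only [twist, hitL, LinearMap.comp_apply, TensorProduct.map_tmul, hu, hv]
  induction Coalgebra.comul (R := k) h with
  | zero => simp
  | add _ _ h₁ h₂ => simp only [map_add, TensorProduct.tmul_add, h₁, h₂]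
  | tmul x y => simp [slot₃, TensorProduct.tmul_smul]

theorem twist_comul_comul_left (hw : ρW w = c ⊗ₜ[k] w) (t : H ⊗[k] H) :
    twist f Coalgebra.comul Coalgebra.comul ρW (TensorProduct.assoc k H H W (t ⊗ₜ[k] w)) =
      TensorProduct.assoc k H H W (hitL (slot₁₂ f c) t ⊗ₜ[k] w) := by
  induction t with
  | zero => simp
  | add _ _ h₁ h₂ => simp only [map_add, TensorProduct.add_tmul, h₁, h₂]
  | tmul h l =>
    simp only [twist, hitL, LinearMap.comp_apply, TensorProduct.map_tmul, hw,
      TensorProduct.assoc_tmul, TensorProduct.comul_tmul]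
    induction Coalgebra.comul (R := k) h with
    | zero => simp
    | add _ _ h₁ h₂ => simp only [map_add, TensorProduct.add_tmul, h₁, h₂]
    | tmul x y =>
      induction Coalgebra.comul (R := k) l with
      | zero => simp
      | add _ _ h₁ h₂ =>
        simp only [map_add, TensorProduct.add_tmul, TensorProduct.tmul_add, h₁, h₂]
      | tmul x' y' => simp [slot₁₂, TensorProduct.smul_tmul']

theorem twist_comul_comul_outer (hv : ρV v = b ⊗ₜ[k] v) (t : H ⊗[k] H) :
    twist f Coalgebra.comul ρV Coalgebra.comul
        (LinearMap.lTensor H (TensorProduct.mk k V H v) t) =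
      LinearMap.lTensor H (TensorProduct.mk k V H v) (hitL (slot₁₃ f b) t) := by
  induction t with
  | zero => simp
  | add _ _ h₁ h₂ => simp only [map_add, h₁, h₂]
  | tmul h l =>
    simp only [twist, hitL, LinearMap.comp_apply, TensorProduct.map_tmul, hv,
      LinearMap.lTensor_tmul, TensorProduct.mk_apply, TensorProduct.comul_tmul]
    induction Coalgebra.comul (R := k) h with
    | zero => simp
    | add _ _ h₁ h₂ => simp only [map_add, TensorProduct.add_tmul, h₁, h₂]
    | tmul x y =>
      induction Coalgebra.comul (R := k) l with
      | zero => simp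
      | add _ _ h₁ h₂ =>
        simp only [map_add, TensorProduct.tmul_add, h₁, h₂]
      | tmul x' y' => simp [slot₁₃]

theorem twist_comul_comul_right (hu : ρU u = a ⊗ₜ[k] u) (t : H ⊗[k] H) :
    twist f ρU Coalgebra.comul Coalgebra.comul (u ⊗ₜ[k] t) =
      u ⊗ₜ[k] hitL (slot₂₃ f a) t := by
  induction t with
  | zero => simp
  | add _ _ h₁ h₂ => simp only [map_add, TensorProduct.tmul_add, h₁, h₂]
  | tmul h l =>
    simp only [twist, hitL, LinearMap.comp_apply, TensorProduct.map_tmul, hu,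
      TensorProduct.comul_tmul]
    induction Coalgebra.comul (R := k) h with
    | zero => simp
    | add _ _ h₁ h₂ => simp only [map_add, TensorProduct.add_tmul, TensorProduct.tmul_add, h₁, h₂]
    | tmul x y =>
      induction Coalgebra.comul (R := k) l with
      | zero => simp
      | add _ _ h₁ h₂ => simp only [map_add, TensorProduct.tmul_add, h₁, h₂]
      | tmul x' y' => simp [slot₂₃, TensorProduct.tmul_smul]

end Twist

theorem IsHomog.halfBraid_act {V : ActCoact k H} {d : YDDatum D} {x : V} (hx : IsHomog V d x)
    (h : H) : halfBraid V.act (h ⊗ₜ[k] x) = x ⊗ₜ[k] hitL (WithConv.toConv d.χ) h := by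
  simp only [halfBraid, hitL, LinearMap.comp_apply, LinearMap.rTensor_tmul]
  induction Coalgebra.comul (R := k) h with
  | zero => simp
  | add _ _ h₁ h₂ => simp only [map_add, TensorProduct.add_tmul, TensorProduct.tmul_add, h₁, h₂]
  | tmul a b => simp [hx.act, TensorProduct.smul_tmul]

theorem IsHomog.assocMap_tmul {U V W : ActCoact k H} {d e f : YDDatum D} {x : U} {y : V} {z : W}
    (hx : IsHomog U d x) (hy : IsHomog V e y) (hz : IsHomog W f z) :
    D.assocMap U.coact V.coact W.coact ((x ⊗ₜ[k] y) ⊗ₜ[k] z) =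
      D.omInv d.g e.g f.g • (x ⊗ₜ[k] (y ⊗ₜ[k] z)) := by
  simp only [assocMap, LinearMap.comp_apply, LinearEquiv.coe_coe, TensorProduct.assoc_tmul]
  exact twist_tmul _ hx.coact hy.coact hz.coact

theorem IsHomog.assocInvMap_tmul {U V W : ActCoact k H} {d e f : YDDatum D} {x : U} {y : V}
    {z : W} (hx : IsHomog U d x) (hy : IsHomog V e y) (hz : IsHomog W f z) :
    D.assocInvMap U.coact V.coact W.coact (x ⊗ₜ[k] (y ⊗ₜ[k] z)) =
      D.om d.g e.g f.g • ((x ⊗ₜ[k] y) ⊗ₜ[k] z) := by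
  simp only [assocInvMap, LinearMap.comp_apply, LinearEquiv.coe_coe]
  rw [twist_tmul _ hx.coact hy.coact hz.coact, map_smul, TensorProduct.assoc_symm_tmul]
  rfl

theorem IsHomog.tmul {V W : ActCoact k H} {d e : YDDatum D} {x : V} {y : W}
    (hx : IsHomog V d x) (hy : IsHomog W e y) :
    IsHomog (D.tensorObj V W) (d * e) (x ⊗ₜ[k] y) where
  coact := by
    change D.tensorCoact V W (x ⊗ₜ[k] y) = _
    simp [tensorCoact, hx.coact, hy.coact]
  act h := by
    change D.tensorAct V W (h ⊗ₜ[k] (x ⊗ₜ[k] y)) = _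
    simp only [tensorAct, assocMap, assocInvMap, LinearMap.comp_apply, LinearEquiv.coe_coe,
      TensorProduct.assoc_symm_tmul, TensorProduct.assoc_tmul, LinearMap.rTensor_tmul,
      LinearMap.lTensor_tmul, hx.halfBraid_act, hy.halfBraid_act,
      twist_comul_left _ hx.coact hy.coact, twist_comul_mid _ hx.coact hy.coact,
      twist_comul_right _ hx.coact hy.coact, hitL_hitL, counit_hitL, TensorProduct.rid_tmul]
    rfl

theorem IsHomog.smul {V : ActCoact k H} {d : YDDatum D} {x : V} (hx : IsHomog V d x) (c : k) :
    IsHomog V d (c • x) where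
  coact := by rw [map_smul, hx.coact, TensorProduct.tmul_smul]
  act h := by rw [TensorProduct.tmul_smul, map_smul, hx.act, smul_comm]

theorem IsHomog.iteratedAct_tmul {V : ActCoact k H} {d : YDDatum D} {x : V} (hx : IsHomog V d x)
    (t : H ⊗[k] H) : D.iteratedAct V (t ⊗ₜ[k] x) = d.χ (D.mul t) • x := by
  have s₁ (t : H ⊗[k] H) : LinearMap.lTensor H (halfBraid V.act)
      (TensorProduct.assoc k H H V (t ⊗ₜ[k] x)) =
      LinearMap.lTensor H (TensorProduct.mk k V H x) (hitL (tens 1 (WithConv.toConv d.χ)) t) := by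
    induction t with
    | zero => simp
    | add _ _ h₁ h₂ => simp only [map_add, TensorProduct.add_tmul, h₁, h₂]
    | tmul h l => simp [hitL_tens, hx.halfBraid_act]
  have s₂ (t : H ⊗[k] H) : LinearMap.rTensor H (halfBraid V.act)
      ((TensorProduct.assoc k H V H).symm (LinearMap.lTensor H (TensorProduct.mk k V H x) t)) =
      (TensorProduct.assoc k V H H).symm
        (x ⊗ₜ[k] hitL (tens (WithConv.toConv d.χ) 1) t) := by
    induction t with
    | zero => simp
    | add _ _ h₁ h₂ => simp only [map_add, TensorProduct.tmul_add, h₁, h₂]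
    | tmul h l => simp [hitL_tens, hx.halfBraid_act]
  simp only [iteratedAct, assocMap, assocInvMap, LinearMap.comp_apply, LinearEquiv.coe_coe,
    twist_comul_comul_left _ hx.coact, s₁, twist_comul_comul_outer _ hx.coact, s₂,
    LinearEquiv.apply_symm_apply, twist_comul_comul_right _ hx.coact, LinearMap.lTensor_tmul,
    hitL_hitL, counit_hitL, TensorProduct.rid_tmul]
  congr 1
  exact (LinearMap.congr_fun (congrArg WithConv.ofConv d.isDatum.chi_mul) t).symm

/-- The module is spanned by homogeneous elements. -/
def SpannedByHomog (D : DualQuasiBialgebra k H) (V : ActCoact k H) : Prop :=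
  Submodule.span k {x : V | ∃ d : YDDatum D, IsHomog V d x} = ⊤

theorem SpannedByHomog.ext {V : ActCoact k H} (hV : SpannedByHomog D V) {M : Type*}
    [AddCommGroup M] [Module k M] {f f' : V →ₗ[k] M}
    (h : ∀ (d : YDDatum D) (x : V), IsHomog V d x → f x = f' x) : f = f' :=
  LinearMap.ext_on hV fun x ⟨d, hx⟩ => h d x hx

theorem SpannedByHomog.ext_tmul {V : ActCoact k H} (hV : SpannedByHomog D V) {N M : Type*}
    [AddCommGroup N] [Module k N] [AddCommGroup M] [Module k M] {f f' : N ⊗[k] V →ₗ[k] M}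
    (h : ∀ (d : YDDatum D) (n : N) (x : V), IsHomog V d x → f (n ⊗ₜ[k] x) = f' (n ⊗ₜ[k] x)) :
    f = f' := by
  refine TensorProduct.ext (LinearMap.ext fun n => hV.ext fun d x hx => ?_)
  exact h d n x hx

/-- A module spanned by homogeneous elements satisfies the axioms of a Yetter-Drinfeld module: on a
homogeneous element they reduce to the axioms of the datum. -/
theorem SpannedByHomog.isYetterDrinfeld {V : ActCoact k H} (hV : SpannedByHomog D V) :
    D.IsYetterDrinfeld V where
  coact_coassoc := hV.ext fun d x hx => by
    simp [hx.coact, d.grouplike.comul_eq_tmul_self]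
  coact_counit := hV.ext fun d x hx => by
    simp [hx.coact, d.grouplike.counit_eq_one]
  mul_act := hV.ext_tmul fun d t x hx => by
    rw [hx.iteratedAct_tmul]
    exact hx.act _
  one_act := fun x => by
    have : V.act ∘ₗ TensorProduct.mk k H V D.one = LinearMap.id := hV.ext fun d x hx => by
      simp [hx.act, d.isDatum.unitary]
    exact LinearMap.congr_fun this x
  compat := hV.ext_tmul fun d h x hx => by
    simp only [LinearMap.comp_apply, hx.halfBraid_act, TensorProduct.map_tmul, hx.coact,
      LinearMap.rTensor_tmul, LinearEquiv.coe_coe, TensorProduct.rightComm_tmul]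
    refine (congrArg (· ⊗ₜ[k] x) (comm_hit d.isDatum h)).trans ?_
    simp only [hitR, LinearMap.comp_apply]
    induction Coalgebra.comul (R := k) h with
    | zero => simp
    | add _ _ h₁ h₂ => simp only [map_add, TensorProduct.add_tmul, h₁, h₂]
    | tmul a b => simp [hx.act, ← TensorProduct.smul_tmul']

theorem isHomog_unitObj (c : k) : IsHomog D.unitObj (1 : YDDatum D) c where
  coact := rfl
  act h := by simp

theorem isHomog_ofDatum (d : YDDatum D) (V : Type u) [AddCommGroup V] [Module k V] (x : V) :
    IsHomog (ActCoact.ofDatum d.g d.χ V) d x where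
  coact := rfl
  act h := by simp

/-- A linear map between modules spanned by homogeneous elements that preserves degrees is a
morphism. -/
theorem isHom_of_span {V W : ActCoact k H} {f : V →ₗ[k] W} {s : Set V}
    (hs : Submodule.span k s = ⊤)
    (h : ∀ x ∈ s, ∃ d : YDDatum D, IsHomog V d x ∧ IsHomog W d (f x)) : ActCoact.IsHom f where
  coact := LinearMap.ext_on hs fun x hx => by
    obtain ⟨d, h₁, h₂⟩ := h x hx
    simp [h₁.coact, h₂.coact]
  act := by
    refine TensorProduct.ext (LinearMap.ext fun n => LinearMap.ext_on hs fun x hx => ?_)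
    obtain ⟨d, h₁, h₂⟩ := h x hx
    simp [h₁.act, h₂.act]

theorem IsHomog.map {V W : ActCoact k H} {f : V →ₗ[k] W} (hf : ActCoact.IsHom f) {d : YDDatum D}
    {x : V} (hx : IsHomog V d x) : IsHomog W d (f x) where
  coact := by
    have := LinearMap.congr_fun hf.coact x
    simpa [hx.coact] using this
  act h := by
    have := LinearMap.congr_fun hf.act (h ⊗ₜ[k] x)
    simpa [hx.act] using this.symm

/-- On homogeneous elements the middle-four interchange is the flip of the middle factors times a
scalar. -/
theorem IsHomog.interchange_tmul {U V W Z : ActCoact k H} {a b c d : YDDatum D} {x : U} {y : V}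
    {z : W} {t : Z} (hx : IsHomog U a x) (hy : IsHomog V b y) (hz : IsHomog W c z)
    (ht : IsHomog Z d t) :
    D.interchange U V W Z ((x ⊗ₜ[k] y) ⊗ₜ[k] (z ⊗ₜ[k] t)) =
      (D.omInv a.g b.g (c * d).g * D.om b.g c.g d.g * c.χ b.g * D.omInv c.g b.g d.g *
        D.om a.g c.g (b * d).g) • ((x ⊗ₜ[k] z) ⊗ₜ[k] (y ⊗ₜ[k] t)) := by
  have e₁ := IsHomog.assocMap_tmul hx hy (hz.tmul ht)
  have e₂ := IsHomog.assocInvMap_tmul hy hz ht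
  have e₃ : V.braid W (y ⊗ₜ[k] z) = c.χ b.g • (z ⊗ₜ[k] y) := by
    simp [ActCoact.braid, hy.coact, hz.act, TensorProduct.smul_tmul']
  have e₄ := IsHomog.assocMap_tmul hz hy ht
  have e₅ := IsHomog.assocInvMap_tmul hx hz (hy.tmul ht)
  simp only [interchange, LinearMap.comp_apply]
  erw [e₁]
  simp only [map_smul, LinearMap.lTensor_tmul, e₂, LinearMap.rTensor_tmul, e₃, e₄,
    TensorProduct.tmul_smul, ← TensorProduct.smul_tmul']
  erw [e₅]
  simp only [smul_smul]
  congr 1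
  ring

end Homog
end DualQuasiBialgebra

/-! ### Gaussian binomial coefficients -/

section QBinom

variable {k : Type u} [Field k] (q : k)

theorem qBinom_zero_right (n : ℕ) : qBinom q n 0 = 1 := by cases n <;> rfl

theorem qBinom_succ_succ (n i : ℕ) :
    qBinom q (n + 1) (i + 1) = qBinom q n i + q ^ (i + 1) * qBinom q n (i + 1) := rfl

theorem qBinom_self (n : ℕ) : qBinom q n n = 1 := by
  induction n with
  | zero => rfl
  | succ n ih => rw [qBinom_succ_succ, ih, qBinom_eq_zero q n (n + 1) (Nat.lt_succ_self n)]; simp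

/-- The two ways of writing a Gaussian trinomial coefficient as a product of Gaussian binomial
coefficients agree: both satisfy the same three-term recurrence. -/
theorem qBinom_mul_qBinom : ∀ a b c : ℕ,
    qBinom q (a + b + c) (a + b) * qBinom q (a + b) a =
      qBinom q (a + b + c) a * qBinom q (b + c) b
  | 0, b, c => by simp [qBinom_zero_right]
  | a + 1, 0, c => by simp [qBinom_zero_right, qBinom_self]
  | a + 1, b + 1, 0 => by simp [qBinom_self]
  | a + 1, b + 1, c + 1 => by
    have h₁ := qBinom_mul_qBinom a (b + 1) (c + 1)
    have h₂ := qBinom_mul_qBinom (a + 1) b (c + 1)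
    have h₃ := qBinom_mul_qBinom (a + 1) (b + 1) c
    rw [show a + 1 + (b + 1) + (c + 1) = a + b + c + 2 + 1 by omega,
      show a + 1 + (b + 1) = a + b + 1 + 1 by omega, show b + 1 + (c + 1) = b + c + 1 + 1 by omega]
    rw [show a + (b + 1) + (c + 1) = a + b + c + 2 by omega,
      show a + (b + 1) = a + b + 1 by omega, show b + 1 + (c + 1) = b + c + 1 + 1 by omega] at h₁
    rw [show a + 1 + b + (c + 1) = a + b + c + 2 by omega,
      show a + 1 + b = a + b + 1 by omega, show b + (c + 1) = b + c + 1 by omega] at h₂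
    rw [show a + 1 + (b + 1) + c = a + b + c + 2 by omega,
      show a + 1 + (b + 1) = a + b + 1 + 1 by omega, show b + 1 + c = b + c + 1 by omega] at h₃
    have e₁ := qBinom_succ_succ q (a + b + c + 2) (a + b + 1)
    have e₂ := qBinom_succ_succ q (a + b + 1) a
    have e₃ := qBinom_succ_succ q (a + b + c + 2) a
    have e₄ := qBinom_succ_succ q (b + c + 1) b
    have p : q ^ (a + b + 1 + 1) = q ^ (a + 1) * q ^ (b + 1) := by rw [← pow_add]; congr 1; omega
    rw [p] at e₁
    linear_combination h₁ + q ^ (a + 1) * h₂ + q ^ (a + 1) * q ^ (b + 1) * h₃ +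
      qBinom q (a + b + 1 + 1) (a + 1) * e₁ + qBinom q (a + b + c + 2) (a + b + 1) * e₂ -
      qBinom q (b + c + 1 + 1) (b + 1) * e₃ -
      q ^ (a + 1) * qBinom q (a + b + c + 2) (a + 1) * e₄

variable {M : Type*} [AddCommGroup M] [Module k M]

theorem sum_qBinom_succ (n : ℕ) (E : ℕ → M) :
    ∑ s ∈ Finset.range (n + 1 + 1), qBinom q (n + 1) s • E s =
      ∑ s ∈ Finset.range (n + 1), qBinom q n s • E (s + 1) +
        ∑ s ∈ Finset.range (n + 1), qBinom q n s • q ^ s • E s := by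
  have h : ∑ s ∈ Finset.range (n + 1), qBinom q n s • q ^ s • E s =
      ∑ s ∈ Finset.range (n + 1 + 1), qBinom q n s • q ^ s • E s := by
    rw [Finset.sum_range_succ _ (n + 1), qBinom_eq_zero q n (n + 1) (Nat.lt_succ_self n)]
    simp
  rw [h, Finset.sum_range_succ' _ (n + 1), Finset.sum_range_succ' _ (n + 1), ← add_assoc,
    ← Finset.sum_add_distrib]
  simp only [qBinom_succ_succ, qBinom_zero_right, add_smul, mul_smul, pow_zero, one_smul]
  congr 1
  refine Finset.sum_congr rfl fun s _ => ?_
  rw [smul_comm]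

/-- The `q`-Vandermonde identity, with arbitrary vectors `E s` in place of the powers of a formal
variable. -/
theorem qVandermonde (a b : ℕ) (E : ℕ → M) :
    ∑ i ∈ Finset.range (a + 1), ∑ j ∈ Finset.range (b + 1),
        (qBinom q a i * qBinom q b j * q ^ ((a - i) * j)) • E (i + j) =
      ∑ s ∈ Finset.range (a + b + 1), qBinom q (a + b) s • E s := by
  induction a generalizing E with
  | zero => simp [qBinom_zero_right]
  | succ a ih =>
    have h := sum_qBinom_succ q a (fun i => ∑ j ∈ Finset.range (b + 1),
      (qBinom q b j * q ^ ((a + 1 - i) * j)) • E (i + j))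
    simp only [Finset.smul_sum, smul_smul, ← mul_assoc] at h
    rw [h, show a + 1 + b + 1 = a + b + 1 + 1 by omega, show a + 1 + b = a + b + 1 by omega,
      sum_qBinom_succ q (a + b) E, ← ih, ← ih]
    congr 1
    · refine Finset.sum_congr rfl fun i _ => Finset.sum_congr rfl fun j _ => ?_
      rw [show a + 1 - (i + 1) = a - i by omega, show i + 1 + j = i + j + 1 by omega]
    · refine Finset.sum_congr rfl fun i hi => Finset.sum_congr rfl fun j _ => ?_
      have hi' : i ≤ a := Nat.lt_succ_iff.mp (Finset.mem_range.mp hi)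
      rw [smul_smul, show a + 1 - i = (a - i) + 1 by omega, add_mul, one_mul, pow_add, pow_add]
      congr 1
      ring

end QBinom

/-! ### The reassociator on the powers of a grouplike element -/

namespace DualQuasiBialgebra
namespace YDDatum

variable {k : Type u} {H : Type v} [Field k] [AddCommGroup H] [Module k H] [Coalgebra k H]
variable {D : DualQuasiBialgebra k H} (d : YDDatum D)

/-- The structure constants of `T(V)`: `v^[a] v^[b] = μ(a, b) v^[a+b]`.  They form a cochain on `ℕ`
whose coboundary is the reassociator on the powers of `g`. -/
def mu (a b : ℕ) : k := ∏ i ∈ Finset.range a, (D.om d.g (d ^ i).g (d ^ b).g)⁻¹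

theorem mu_ne_zero (a b : ℕ) : d.mu a b ≠ 0 :=
  Finset.prod_ne_zero_iff.mpr fun i _ =>
    inv_ne_zero (D.om_ne_zero d.grouplike (d ^ i).grouplike (d ^ b).grouplike)

@[simp] theorem mu_zero_left (b : ℕ) : d.mu 0 b = 1 := by simp [mu]

theorem mu_succ (a b : ℕ) : d.mu (a + 1) b = d.mu a b * (D.om d.g (d ^ a).g (d ^ b).g)⁻¹ := by
  rw [mu, Finset.prod_range_succ, mu]

@[simp] theorem mu_one_left (b : ℕ) : d.mu 1 b = 1 := by
  rw [mu_succ, mu_zero_left, pow_zero, one_g, D.om_one_mid d.grouplike (d ^ b).grouplike]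
  simp

@[simp] theorem mu_zero_right (a : ℕ) : d.mu a 0 = 1 :=
  Finset.prod_eq_one fun i _ => by
    rw [pow_zero, one_g, D.om_one_right d.grouplike (d ^ i).grouplike, inv_one]

theorem om_pow_cocycle (a b c e : ℕ) :
    D.om (d ^ b).g (d ^ c).g (d ^ e).g * D.om (d ^ a).g (d ^ (b + c)).g (d ^ e).g *
        D.om (d ^ a).g (d ^ b).g (d ^ c).g =
      D.om (d ^ a).g (d ^ b).g (d ^ (c + e)).g * D.om (d ^ (a + b)).g (d ^ c).g (d ^ e).g := by
  simp only [pow_add, mul_g]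
  exact D.om_cocycle (d ^ a).grouplike (d ^ b).grouplike (d ^ c).grouplike (d ^ e).grouplike

/-- The reassociator on the powers of `g` is the coboundary of `μ`. -/
theorem om_pow_mul_mu (a b c : ℕ) :
    D.om (d ^ a).g (d ^ b).g (d ^ c).g * (d.mu a b * d.mu (a + b) c) =
      d.mu b c * d.mu a (b + c) := by
  induction a with
  | zero => simp [D.om_one_left (d ^ b).grouplike (d ^ c).grouplike]
  | succ a ih =>
    have h := d.om_pow_cocycle 1 a b c
    rw [pow_one] at h
    have n₁ := D.om_ne_zero d.grouplike (d ^ a).grouplike (d ^ b).grouplike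
    have n₂ := D.om_ne_zero d.grouplike (d ^ a).grouplike (d ^ (b + c)).grouplike
    have n₃ := D.om_ne_zero d.grouplike (d ^ (a + b)).grouplike (d ^ c).grouplike
    rw [add_comm 1 a] at h
    rw [show a + 1 + b = a + b + 1 by omega, mu_succ, mu_succ, mu_succ]
    field_simp
    linear_combination (D.om d.g (d ^ a).g (d ^ b).g * D.om d.g (d ^ (a + b)).g (d ^ c).g) * ih -
      (d.mu a b * d.mu (a + b) c) * h

theorem om_pow (a b c : ℕ) : D.om (d ^ a).g (d ^ b).g (d ^ c).g =
    d.mu b c * d.mu a (b + c) / (d.mu a b * d.mu (a + b) c) := by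
  rw [eq_div_iff (mul_ne_zero (d.mu_ne_zero _ _) (d.mu_ne_zero _ _)), om_pow_mul_mu]

theorem omInv_pow (a b c : ℕ) : D.omInv (d ^ a).g (d ^ b).g (d ^ c).g =
    d.mu a b * d.mu (a + b) c / (d.mu b c * d.mu a (b + c)) := by
  rw [D.omInv_eq_inv (d ^ a).grouplike (d ^ b).grouplike (d ^ c).grouplike, om_pow, inv_div]

theorem chi_mul_grouplike {h l : H} (hh : IsGroupLikeElem k h) (hl : IsGroupLikeElem k l) :
    d.χ (D.mul (h ⊗ₜ[k] l)) = (D.om h l d.g)⁻¹ * d.χ l * D.om h d.g l * d.χ h *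
      (D.om d.g h l)⁻¹ := by
  have e := congrArg (evalGrouplike (hh.tmul hl)) d.isDatum.chi_mul
  simp only [map_mul] at e
  rw [← D.omInv_eq_inv hh hl d.grouplike, ← D.omInv_eq_inv d.grouplike hh hl]
  refine e.trans ?_
  simp only [evalGrouplike, MonoidHom.coe_mk, OneHom.coe_mk, LinearMap.comp_apply,
    TensorProduct.map_tmul, hh.counit_eq_one, hl.counit_eq_one, LinearEquiv.coe_coe,
    TensorProduct.lid_tmul, smul_eq_mul, mul_one, one_mul]
  rfl

/-- The values of `χ` on the powers of `g`.  Peeling off one factor of `g` brings in three values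
of the reassociator, whose expressions in `μ` telescope. -/
theorem chi_pow_self (j : ℕ) : d.χ (d ^ j).g = d.χ d.g ^ j * d.mu j 1 := by
  induction j with
  | zero => simp [d.isDatum.unitary]
  | succ j ih =>
    have h := d.om_pow 1 j 1
    have h' := d.om_pow 1 1 j
    simp only [pow_one] at h h'
    rw [pow_succ' d, mul_g, chi_mul_grouplike d d.grouplike (d ^ j).grouplike, ih, h, h']
    have n₁ := d.mu_ne_zero j 1
    have n₂ := d.mu_ne_zero (1 + 1) j
    have n₃ := d.mu_ne_zero (1 + j) 1
    simp only [mu_one_left, add_comm 1 j] at *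
    field_simp
    ring

/-- The prebraiding on powers of `g` is the bicharacter `q ^ (j n)` of the integers, twisted by
`μ`. -/
theorem chi_pow (n j : ℕ) :
    (d ^ n).χ (d ^ j).g = d.χ d.g ^ (j * n) * d.mu j n / d.mu n j := by
  induction n with
  | zero => simp [(d ^ j).grouplike.counit_eq_one]
  | succ n ih =>
    have h₁ := d.om_pow j 1 n
    have h₂ := d.om_pow 1 j n
    have h₃ := d.om_pow 1 n j
    simp only [pow_one] at h₁ h₂ h₃
    rw [pow_succ' d n, mul_chi, chiMul_apply_grouplike d.grouplike (d ^ n).grouplike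
      (d ^ j).grouplike, WithConv.ofConv_toConv, WithConv.ofConv_toConv, ih, h₁, h₂, h₃,
      chi_pow_self]
    have n₁ := d.mu_ne_zero j 1
    have n₂ := d.mu_ne_zero j n
    have n₃ := d.mu_ne_zero n j
    have n₄ := d.mu_ne_zero (j + 1) n
    have n₅ := d.mu_ne_zero (n + 1) j
    simp only [mu_one_left, add_comm 1 j, add_comm 1 n] at *
    field_simp
    ring

/-- The coefficients of the comultiplication are Gaussian binomial coefficients divided by the
structure constants of the multiplication. -/
theorem beta_eq (q : k) (i j : ℕ) :
    D.beta d.g q i (i + j) = qBinom q (i + j) i / d.mu i j := by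
  rw [beta, Nat.add_sub_cancel_left, div_eq_mul_inv, mu, Finset.prod_inv_distrib, inv_inv]
  simp only [pow_g]

end YDDatum
end DualQuasiBialgebra

/-! ### Algebras with a homogeneous basis indexed by the natural numbers -/

namespace DualQuasiBialgebra

open Finset.HasAntidiagonal (antidiagonal mem_antidiagonal)

/-- The counit `b n ↦ δ_{n,0}`. -/
def gradedCounit {k M : Type*} [Field k] [AddCommGroup M] [Module k M]
    (b : Module.Basis ℕ k M) : M →ₗ[k] k :=
  b.constr k fun n => if n = 0 then 1 else 0

theorem gradedCounit_basis {k M : Type*} [Field k] [AddCommGroup M] [Module k M]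
    (b : Module.Basis ℕ k M) (n : ℕ) : gradedCounit b (b n) = if n = 0 then 1 else 0 :=
  b.constr_basis k _ n

section HomogBasis

variable {k : Type u} {H : Type v} [Field k] [AddCommGroup H] [Module k H] [Coalgebra k H]
variable {D : DualQuasiBialgebra k H}

theorem IsHomog.zero (V : ActCoact k H) (d : YDDatum D) : IsHomog V d 0 where
  coact := by simp
  act h := by simp

theorem IsHomog.add {V : ActCoact k H} {d : YDDatum D} {x y : V} (hx : IsHomog V d x)
    (hy : IsHomog V d y) : IsHomog V d (x + y) where
  coact := by rw [map_add, hx.coact, hy.coact, TensorProduct.tmul_add]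
  act h := by rw [TensorProduct.tmul_add, map_add, hx.act, hy.act, smul_add]

theorem IsHomog.sum {V : ActCoact k H} {d : YDDatum D} {ι : Type*} {s : Finset ι} {f : ι → V}
    (h : ∀ i ∈ s, IsHomog V d (f i)) : IsHomog V d (∑ i ∈ s, f i) :=
  Finset.sum_induction f (IsHomog V d) (fun _ _ => IsHomog.add) (IsHomog.zero V d) h

variable {d : YDDatum D} {T : ActCoact k H} {b : Module.Basis ℕ k T}
  {m : T ⊗[k] T →ₗ[k] T}

theorem spannedByHomog_of_basis (hb : ∀ n, IsHomog T (d ^ n) (b n)) : SpannedByHomog D T := by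
  refine top_unique ?_
  rw [← b.span_eq]
  refine Submodule.span_mono ?_
  rintro _ ⟨n, rfl⟩
  exact ⟨_, hb n⟩

/-- Associativity holds because the reassociator on the powers of `g` is the coboundary of `μ`. -/
theorem isAlgebra_of_basis (hb : ∀ n, IsHomog T (d ^ n) (b n))
    (hm : ∀ i j, m (b i ⊗ₜ[k] b j) = d.mu i j • b (i + j)) : D.IsAlgebra T m (b 0) where
  isYD := (spannedByHomog_of_basis hb).isYetterDrinfeld
  mul_hom := isHom_of_span (b.tensorProduct b).span_eq <| by
    rintro _ ⟨⟨i, j⟩, rfl⟩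
    refine ⟨d ^ i * d ^ j, ?_, ?_⟩
    · rw [Module.Basis.tensorProduct_apply]
      exact (hb i).tmul (hb j)
    · rw [Module.Basis.tensorProduct_apply, hm, ← pow_add]
      exact (hb _).smul _
  one_hom := isHom_of_span (s := Set.univ) Submodule.span_univ fun c _ =>
    ⟨1, isHomog_unitObj c, by
      have := (hb 0).smul c
      rw [pow_zero] at this
      exact this⟩
  mul_assoc := by
    refine ((b.tensorProduct b).tensorProduct b).ext ?_
    rintro ⟨⟨i, j⟩, l⟩
    rw [Module.Basis.tensorProduct_apply, Module.Basis.tensorProduct_apply]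
    simp only [LinearMap.comp_apply, LinearMap.rTensor_tmul, hm]
    rw [IsHomog.assocMap_tmul (hb i) (hb j) (hb l), map_smul, LinearMap.lTensor_tmul, hm,
      ← TensorProduct.smul_tmul', TensorProduct.tmul_smul, map_smul, map_smul, map_smul, hm, hm,
      smul_smul, smul_smul, smul_smul, add_assoc, d.omInv_pow]
    congr 1
    have n₁ := d.mu_ne_zero j l
    have n₂ := d.mu_ne_zero i (j + l)
    field_simp
  one_mul x := by
    have : m ∘ₗ TensorProduct.mk k T T (b 0) = LinearMap.id := b.ext fun n => by simp [hm]
    exact LinearMap.congr_fun this x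
  mul_one x := by
    have : m ∘ₗ (TensorProduct.mk k T T).flip (b 0) = LinearMap.id := b.ext fun n => by simp [hm]
    exact LinearMap.congr_fun this x

/-- The comultiplication `b n ↦ ∑ β(i, n) b i ⊗ b (n - i)`. -/
def gaussComul (d : YDDatum D) (b : Module.Basis ℕ k T) : T →ₗ[k] T ⊗[k] T :=
  b.constr k fun n => ∑ p ∈ antidiagonal n,
    (qBinom (d.χ d.g) n p.1 / d.mu p.1 p.2) • (b p.1 ⊗ₜ[k] b p.2)

theorem gaussComul_basis (n : ℕ) : gaussComul d b (b n) = ∑ p ∈ antidiagonal n,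
    (qBinom (d.χ d.g) n p.1 / d.mu p.1 p.2) • (b p.1 ⊗ₜ[k] b p.2) :=
  b.constr_basis k _ n

theorem gaussComul_basis_zero : gaussComul d b (b 0) = b 0 ⊗ₜ[k] b 0 := by
  simp [gaussComul_basis, qBinom_zero_right]

theorem gaussComul_basis_one :
    gaussComul d b (b 1) = b 1 ⊗ₜ[k] b 0 + b 0 ⊗ₜ[k] b 1 := by
  simp [gaussComul_basis, Finset.Nat.antidiagonal_succ, qBinom_zero_right, qBinom_self, add_comm]

/-- The two ways of summing over triples with sum `n`. -/
theorem sum_antidiagonal_assoc {M : Type*} [AddCommMonoid M] (n : ℕ) (f : ℕ → ℕ → ℕ → M) :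
    ∑ p ∈ antidiagonal n, ∑ r ∈ antidiagonal p.1, f r.1 r.2 p.2 =
      ∑ p ∈ antidiagonal n, ∑ r ∈ antidiagonal p.2, f p.1 r.1 r.2 := by
  rw [Finset.sum_sigma', Finset.sum_sigma']
  refine Finset.sum_nbij' (fun z => ⟨(z.2.1, z.2.2 + z.1.2), (z.2.2, z.1.2)⟩)
    (fun z => ⟨(z.1.1 + z.2.1, z.2.2), (z.1.1, z.2.1)⟩) ?_ ?_ ?_ ?_ ?_
  · rintro ⟨⟨s, l⟩, ⟨i, j⟩⟩ h
    simp only [Finset.mem_sigma, mem_antidiagonal] at h ⊢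
    exact ⟨by omega, trivial⟩
  · rintro ⟨⟨s, l⟩, ⟨i, j⟩⟩ h
    simp only [Finset.mem_sigma, mem_antidiagonal] at h ⊢
    exact ⟨by omega, trivial⟩
  · rintro ⟨⟨s, l⟩, ⟨i, j⟩⟩ h
    simp only [Finset.mem_sigma, mem_antidiagonal] at h
    obtain ⟨-, rfl⟩ := h
    rfl
  · rintro ⟨⟨s, l⟩, ⟨i, j⟩⟩ h
    simp only [Finset.mem_sigma, mem_antidiagonal] at h
    obtain ⟨-, rfl⟩ := h
    rfl
  · rintro ⟨⟨s, l⟩, ⟨i, j⟩⟩ h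
    rfl

/-- On basis vectors, coassociativity is the identity between the two factorizations of a Gaussian
trinomial coefficient; the reassociator again cancels against values of `μ`. -/
theorem isCoalgebra_of_basis (hb : ∀ n, IsHomog T (d ^ n) (b n)) :
    D.IsCoalgebra T (gaussComul d b) (gradedCounit b) where
  isYD := (spannedByHomog_of_basis hb).isYetterDrinfeld
  comul_hom := isHom_of_span b.span_eq <| by
    rintro _ ⟨n, rfl⟩
    refine ⟨_, hb n, ?_⟩
    rw [gaussComul_basis]
    refine IsHomog.sum fun p hp => IsHomog.smul ?_ _
    rw [← mem_antidiagonal.mp hp, pow_add]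
    exact (hb _).tmul (hb _)
  counit_hom := isHom_of_span b.span_eq <| by
    rintro _ ⟨n, rfl⟩
    refine ⟨_, hb n, ?_⟩
    rw [gradedCounit_basis]
    split_ifs with h
    · rw [h, pow_zero]
      exact isHomog_unitObj 1
    · exact IsHomog.zero _ _
  coassoc := b.ext fun n => by
    simp only [LinearMap.comp_apply, gaussComul_basis, map_sum, map_smul, LinearMap.rTensor_tmul,
      LinearMap.lTensor_tmul, TensorProduct.sum_tmul, TensorProduct.tmul_sum,
      ← TensorProduct.smul_tmul', TensorProduct.tmul_smul, Finset.smul_sum,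
      IsHomog.assocMap_tmul (hb _) (hb _) (hb _), smul_smul]
    have e₁ : ∀ p ∈ antidiagonal n, ∀ r ∈ antidiagonal p.1,
        (qBinom (d.χ d.g) n p.1 / d.mu p.1 p.2 * (qBinom (d.χ d.g) p.1 r.1 / d.mu r.1 r.2) *
          D.omInv (d ^ r.1).g (d ^ r.2).g (d ^ p.2).g) •
            (b r.1 ⊗ₜ[k] (b r.2 ⊗ₜ[k] b p.2)) =
        (qBinom (d.χ d.g) n (r.1 + r.2) * qBinom (d.χ d.g) (r.1 + r.2) r.1 /
          (d.mu r.2 p.2 * d.mu r.1 (r.2 + p.2))) • (b r.1 ⊗ₜ[k] (b r.2 ⊗ₜ[k] b p.2)) := by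
      intro p _ r hr
      rw [← mem_antidiagonal.mp hr, d.omInv_pow]
      congr 1
      have n₁ := d.mu_ne_zero (r.1 + r.2) p.2
      have n₂ := d.mu_ne_zero r.1 r.2
      have n₃ := d.mu_ne_zero r.2 p.2
      have n₄ := d.mu_ne_zero r.1 (r.2 + p.2)
      field_simp
    rw [Finset.sum_congr rfl fun p hp => Finset.sum_congr rfl (e₁ p hp)]
    rw [sum_antidiagonal_assoc n fun i j l =>
      (qBinom (d.χ d.g) n (i + j) * qBinom (d.χ d.g) (i + j) i /
          (d.mu j l * d.mu i (j + l))) • (b i ⊗ₜ[k] (b j ⊗ₜ[k] b l))]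
    refine Finset.sum_congr rfl fun p hp => Finset.sum_congr rfl fun r hr => ?_
    have hr' := mem_antidiagonal.mp hr
    have hp' := mem_antidiagonal.mp hp
    have h := qBinom_mul_qBinom (d.χ d.g) p.1 r.1 r.2
    rw [add_assoc, hr', hp'] at h
    rw [h, hr']
    congr 1
    have n₁ := d.mu_ne_zero r.1 r.2
    have n₂ := d.mu_ne_zero p.1 p.2
    field_simp
  counit_comul := b.ext fun n => by
    simp only [LinearMap.comp_apply, gaussComul_basis, map_sum, map_smul, LinearMap.rTensor_tmul,
      LinearEquiv.coe_coe, TensorProduct.lid_tmul, gradedCounit_basis]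
    rw [Finset.sum_eq_single (0, n)]
    · simp [qBinom_zero_right]
    · rintro ⟨i, j⟩ hp hne
      rw [if_neg, zero_smul, smul_zero]
      rintro rfl
      exact hne (by simpa using hp)
    · simp
  comul_counit := b.ext fun n => by
    simp only [LinearMap.comp_apply, gaussComul_basis, map_sum, map_smul, LinearMap.lTensor_tmul,
      LinearEquiv.coe_coe, TensorProduct.rid_tmul, gradedCounit_basis]
    rw [Finset.sum_eq_single (n, 0)]
    · simp [qBinom_self]
    · rintro ⟨i, j⟩ hp hne
      rw [if_neg, zero_smul, smul_zero]
      rintro rfl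
      exact hne (by simpa using hp)
    · simp

/-- The value of the interchange on basis vectors: in terms of `μ` the reassociators and the
prebraiding combine into `q ^ (j * l)` times a coboundary. -/
theorem interchange_basis (hb : ∀ n, IsHomog T (d ^ n) (b n)) (i j l r : ℕ) :
    D.interchange T T T T ((b i ⊗ₜ[k] b j) ⊗ₜ[k] (b l ⊗ₜ[k] b r)) =
      (d.χ d.g ^ (j * l) * (d.mu i j * d.mu (i + j) (l + r) * d.mu l r) /
        (d.mu j r * d.mu i l * d.mu (i + l) (j + r))) •
          ((b i ⊗ₜ[k] b l) ⊗ₜ[k] (b j ⊗ₜ[k] b r)) := by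
  rw [IsHomog.interchange_tmul (hb i) (hb j) (hb l) (hb r), ← pow_add, ← pow_add, d.omInv_pow,
    d.omInv_pow, d.om_pow, d.om_pow, d.chi_pow, add_comm l j, add_left_comm l j r]
  congr 1
  have n₁ := d.mu_ne_zero j r
  have n₂ := d.mu_ne_zero i l
  have n₃ := d.mu_ne_zero (i + l) (j + r)
  have n₄ := d.mu_ne_zero j (l + r)
  have n₅ := d.mu_ne_zero i (j + (l + r))
  have n₆ := d.mu_ne_zero j l
  have n₇ := d.mu_ne_zero (j + l) r
  have n₈ := d.mu_ne_zero l j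
  have n₉ := d.mu_ne_zero l (j + r)
  field_simp

/-- After cancelling the values of `μ`, multiplicativity of the comultiplication on basis vectors is
the `q`-Vandermonde identity. -/
theorem isBialgebra_of_basis (hb : ∀ n, IsHomog T (d ^ n) (b n))
    (hm : ∀ i j, m (b i ⊗ₜ[k] b j) = d.mu i j • b (i + j)) :
    D.IsBialgebra T m (b 0) (gaussComul d b) (gradedCounit b) where
  isAlgebra := isAlgebra_of_basis hb hm
  isCoalgebra := isCoalgebra_of_basis hb
  comul_mul := by
    refine (b.tensorProduct b).ext ?_
    rintro ⟨a, c⟩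
    have hΔ (n : ℕ) : gaussComul d b (b n) = ∑ i ∈ Finset.range (n + 1),
        (qBinom (d.χ d.g) n i / d.mu i (n - i)) • (b i ⊗ₜ[k] b (n - i)) := by
      rw [gaussComul_basis]
      exact Finset.Nat.sum_antidiagonal_eq_sum_range_succ
        (fun i j => (qBinom (d.χ d.g) n i / d.mu i j) • (b i ⊗ₜ[k] b j)) n
    rw [Module.Basis.tensorProduct_apply]
    simp only [LinearMap.comp_apply, hm, map_smul, TensorProduct.map_tmul, hΔ,
      TensorProduct.sum_tmul, TensorProduct.tmul_sum, ← TensorProduct.smul_tmul',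
      TensorProduct.tmul_smul, map_sum, interchange_basis hb, smul_smul]
    have h := qVandermonde (d.χ d.g) a c fun s =>
      (d.mu a c / d.mu s (a + c - s)) • (b s ⊗ₜ[k] b (a + c - s))
    simp only [Finset.smul_sum, smul_smul]
    rw [Finset.sum_comm]
    refine Eq.trans ?_ (h.symm.trans ?_)
    · refine Finset.sum_congr rfl fun s _ => ?_
      rw [smul_smul]
      congr 1
      ring
    · refine Finset.sum_congr rfl fun i hi => Finset.sum_congr rfl fun l hl => ?_
      obtain ⟨j, rfl⟩ := Nat.exists_eq_add_of_le (Nat.lt_succ_iff.mp (Finset.mem_range.mp hi))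
      obtain ⟨r, rfl⟩ := Nat.exists_eq_add_of_le (Nat.lt_succ_iff.mp (Finset.mem_range.mp hl))
      rw [show i + j + (l + r) - (i + l) = j + r by omega, Nat.add_sub_cancel_left,
        Nat.add_sub_cancel_left, smul_smul]
      congr 1
      have n₁ := d.mu_ne_zero j r
      have n₂ := d.mu_ne_zero i l
      have n₃ := d.mu_ne_zero (i + l) (j + r)
      have n₄ := d.mu_ne_zero i j
      have n₅ := d.mu_ne_zero l r
      field_simp
  comul_one := gaussComul_basis_zero
  counit_mul x y := by
    have : gradedCounit b ∘ₗ m =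
        LinearMap.mul' k k ∘ₗ TensorProduct.map (gradedCounit b) (gradedCounit b) := by
      refine (b.tensorProduct b).ext ?_
      rintro ⟨i, j⟩
      rw [Module.Basis.tensorProduct_apply]
      simp only [LinearMap.comp_apply, hm, map_smul, gradedCounit_basis, TensorProduct.map_tmul,
        LinearMap.mul'_apply]
      by_cases hi : i = 0 <;> by_cases hj : j = 0 <;> simp [hi, hj]
    exact LinearMap.congr_fun this (x ⊗ₜ[k] y)
  counit_one := by simp [gradedCounit_basis]

/-- `b 1` generates the algebra, so two bialgebra structures that agree on it are equal. -/
theorem isBialgebra_unique (hm : ∀ i j, m (b i ⊗ₜ[k] b j) = d.mu i j • b (i + j))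
    {Δ Δ' : T →ₗ[k] T ⊗[k] T} {ε ε' : T →ₗ[k] k} (h : D.IsBialgebra T m (b 0) Δ ε)
    (h' : D.IsBialgebra T m (b 0) Δ' ε') (hΔ : Δ (b 1) = Δ' (b 1)) (hε : ε (b 1) = ε' (b 1)) :
    Δ = Δ' ∧ ε = ε' := by
  have hs (n : ℕ) : b (n + 1) = m (b 1 ⊗ₜ[k] b n) := by
    rw [hm, d.mu_one_left, one_smul, add_comm]
  constructor
  · refine b.ext fun n => ?_
    induction n with
    | zero => rw [h.comul_one, h'.comul_one]
    | succ n ih =>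
      have e := LinearMap.congr_fun h.comul_mul (b 1 ⊗ₜ[k] b n)
      have e' := LinearMap.congr_fun h'.comul_mul (b 1 ⊗ₜ[k] b n)
      simp only [LinearMap.comp_apply, TensorProduct.map_tmul] at e e'
      rw [hs, e, e', hΔ, ih]
  · refine b.ext fun n => ?_
    induction n with
    | zero => rw [h.counit_one, h'.counit_one]
    | succ n ih => rw [hs, h.counit_mul, h'.counit_mul, hε, ih]

/-- The algebra is free on `b 1`: a homogeneous element `y` of degree `d` in an algebra `A` is the
image of `b 1` under a unique morphism of algebras. -/
theorem exists_unique_lift_of_basis (hb : ∀ n, IsHomog T (d ^ n) (b n))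
    (hm : ∀ i j, m (b i ⊗ₜ[k] b j) = d.mu i j • b (i + j)) {A : ActCoact k H}
    {mA : A ⊗[k] A →ₗ[k] A} {e : A} (hA : D.IsAlgebra A mA e) {y : A} (hy : IsHomog A d y) :
    ∃! F : T →ₗ[k] A, ActCoact.IsHom F ∧ F ∘ₗ m = mA ∘ₗ TensorProduct.map F F ∧
      F (b 0) = e ∧ F (b 1) = y := by
  -- the image of `b n` can only be the right-bracketed power `y (y (⋯ (y e)))`
  let z : ℕ → A := fun n => Nat.rec e (fun _ w => mA (y ⊗ₜ[k] w)) n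
  have z_succ (n : ℕ) : z (n + 1) = mA (y ⊗ₜ[k] z n) := rfl
  have hz (n : ℕ) : IsHomog A (d ^ n) (z n) := by
    induction n with
    | zero =>
      have := (isHomog_unitObj (D := D) 1).map hA.one_hom
      rw [LinearMap.toSpanSingleton_apply, one_smul] at this
      rw [pow_zero]
      exact this
    | succ n ih =>
      rw [pow_succ', z_succ]
      exact (hy.tmul ih).map hA.mul_hom
  have hmul (i j : ℕ) : mA (z i ⊗ₜ[k] z j) = d.mu i j • z (i + j) := by
    induction i with
    | zero => rw [zero_add, d.mu_zero_left, one_smul]; exact hA.one_mul _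
    | succ i ih =>
      have h := LinearMap.congr_fun hA.mul_assoc ((y ⊗ₜ[k] z i) ⊗ₜ[k] z j)
      simp only [LinearMap.comp_apply, LinearMap.rTensor_tmul] at h
      rw [z_succ, h, IsHomog.assocMap_tmul hy (hz i) (hz j), map_smul, map_smul,
        LinearMap.lTensor_tmul, ih, TensorProduct.tmul_smul, map_smul, smul_smul, ← z_succ,
        d.mu_succ, D.omInv_eq_inv d.grouplike (d ^ i).grouplike (d ^ j).grouplike, mul_comm,
        show i + 1 + j = i + j + 1 by omega]
  let F : T →ₗ[k] A := b.constr k z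
  have hF (n : ℕ) : F (b n) = z n := b.constr_basis k z n
  refine ⟨F, ⟨?_, ?_, hF 0, ?_⟩, ?_⟩
  · refine isHom_of_span (D := D) b.span_eq ?_
    rintro _ ⟨n, rfl⟩
    exact ⟨_, hb n, by rw [hF]; exact hz n⟩
  · refine (b.tensorProduct b).ext ?_
    rintro ⟨i, j⟩
    rw [Module.Basis.tensorProduct_apply]
    simp only [LinearMap.comp_apply, TensorProduct.map_tmul, hm, map_smul, hF, hmul]
  · rw [hF]; exact hA.mul_one y
  · rintro G ⟨-, hG, hG₀, hG₁⟩
    refine b.ext fun n => ?_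
    rw [hF]
    induction n with
    | zero => exact hG₀
    | succ n ih =>
      have h := LinearMap.congr_fun hG (b 1 ⊗ₜ[k] b n)
      simp only [LinearMap.comp_apply, TensorProduct.map_tmul, hm, d.mu_one_left, one_smul, hG₁,
        ih] at h
      rw [add_comm, h, add_comm]

end HomogBasis
end DualQuasiBialgebra

/-! ### The tensor algebra of a one-dimensional Yetter-Drinfeld module -/

namespace DualQuasiBialgebra

section TensorAlgebra

variable {k : Type u} {H : Type v} [Field k] [AddCommGroup H] [Module k H] [Coalgebra k H]
variable {D : DualQuasiBialgebra k H} {V : ActCoact k H} {d : YDDatum D} {x : V}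

theorem isHomog_vpowAux (hx : IsHomog V d x) :
    ∀ n : ℕ, IsHomog (D.tpow V n) (d ^ n) (D.vpowAux V x n)
  | 0 => by rw [pow_zero]; exact isHomog_unitObj (1 : k)
  | 1 => by rw [pow_one]; exact hx
  | n + 2 => by
    rw [pow_succ']
    exact hx.tmul (isHomog_vpowAux hx (n + 1))

theorem isHom_incl (n : ℕ) :
    ActCoact.IsHom (V := D.tpow V n) (W := D.tensorAlg V) (D.incl V n) where
  coact := by
    refine LinearMap.ext fun y => ?_
    change (DirectSum.toModule k ℕ _ fun n =>
      LinearMap.lTensor H (D.incl V n) ∘ₗ (D.tpow V n).coact) (D.incl V n y) = _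
    rw [incl, DirectSum.toModule_lof]
    rfl
  act := by
    refine TensorProduct.ext' fun h y => ?_
    refine Eq.symm ?_
    change (DirectSum.toModule k ℕ _ fun n =>
      (TensorProduct.curry (D.incl V n ∘ₗ (D.tpow V n).act)).flip) (D.incl V n y) h = _
    rw [incl, DirectSum.toModule_lof]
    rfl

theorem isHomog_vpow (hx : IsHomog V d x) (n : ℕ) :
    IsHomog (D.tensorAlg V) (d ^ n) (D.vpow V x n) :=
  (isHomog_vpowAux hx n).map (isHom_incl n)

theorem cons_tmul_incl (n : ℕ) (y : V) (z : D.tpow V n) :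
    D.cons V (y ⊗ₜ[k] D.incl V n z) = D.incl V (n + 1) (D.consPow V n (y ⊗ₜ[k] z)) := by
  change (DirectSum.toModule k ℕ _ fun n =>
    (TensorProduct.curry (D.incl V (n + 1) ∘ₗ D.consPow V n)).flip) (D.incl V n z) y = _
  rw [incl, DirectSum.toModule_lof]
  rfl

theorem consPow_tmul_vpowAux (x : V) : ∀ n : ℕ,
    D.consPow V n (x ⊗ₜ[k] D.vpowAux V x n) = D.vpowAux V x (n + 1)
  | 0 => (TensorProduct.rid_tmul x (1 : k)).trans (one_smul k x)
  | _ + 1 => rfl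

theorem cons_tmul_vpow (x : V) (n : ℕ) :
    D.cons V (x ⊗ₜ[k] D.vpow V x n) = D.vpow V x (n + 1) := by
  rw [vpow, cons_tmul_incl, consPow_tmul_vpowAux]
  rfl

/-- The recursion for the product in `T(V)` produces one value of `ω⁻¹` for each factor `v`. -/
theorem mulPow_vpowAux_tmul (hx : IsHomog V d x) (n : ℕ) : ∀ a : ℕ,
    D.mulPow V a (D.vpowAux V x a ⊗ₜ[k] D.vpow V x n) = d.mu a n • D.vpow V x (a + n)
  | 0 => by
    rw [d.mu_zero_left, zero_add]
    exact TensorProduct.lid_tmul _ _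
  | 1 => by
    rw [d.mu_one_left, one_smul, add_comm]
    exact cons_tmul_vpow x n
  | a + 2 => by
    have h := mulPow_vpowAux_tmul hx n (a + 1)
    have e := IsHomog.assocMap_tmul hx (isHomog_vpowAux hx (a + 1)) (isHomog_vpow hx n)
    change D.cons V (LinearMap.lTensor V (D.mulPow V (a + 1))
      (D.assocMap V.coact (D.tpow V (a + 1)).coact (D.tensorAlg V).coact
        ((x ⊗ₜ[k] D.vpowAux V x (a + 1)) ⊗ₜ[k] D.vpow V x n))) = _
    rw [e, map_smul, LinearMap.lTensor_tmul, h, TensorProduct.tmul_smul, map_smul, map_smul,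
      smul_smul, cons_tmul_vpow, d.mu_succ (a + 1),
      D.omInv_eq_inv d.grouplike (d ^ (a + 1)).grouplike (d ^ n).grouplike, mul_comm,
      show a + 2 + n = a + 1 + n + 1 by omega]

theorem tmul_vpow (hx : IsHomog V d x) (a n : ℕ) :
    D.tmul V (D.vpow V x a ⊗ₜ[k] D.vpow V x n) = d.mu a n • D.vpow V x (a + n) := by
  rw [← mulPow_vpowAux_tmul hx]
  change (DirectSum.toModule k ℕ _ fun n => TensorProduct.curry (D.mulPow V n))
    (D.incl V a (D.vpowAux V x a)) (D.vpow V x n) = _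
  rw [incl, DirectSum.toModule_lof]
  rfl

/-- The basis of `Tⁿ(V)` consisting of `v^[n]`, for a basis of `V` with a single element `v`. -/
theorem exists_basis_tpow (bV : Module.Basis Unit k V) : ∀ n : ℕ,
    ∃ c : Module.Basis Unit k (D.tpow V n), c () = D.vpowAux V (bV ()) n
  | 0 => ⟨Module.Basis.singleton Unit k, Module.Basis.singleton_apply Unit k ()⟩
  | 1 => ⟨bV, rfl⟩
  | n + 2 => by
    obtain ⟨c, hc⟩ := exists_basis_tpow bV (n + 1)
    have h : (bV.tensorProduct c).reindex (Equiv.prodUnique Unit Unit) () = bV () ⊗ₜ[k] c () := by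
      rw [Module.Basis.reindex_apply]
      exact Module.Basis.tensorProduct_apply bV c () ()
    exact ⟨_, h.trans (congrArg (bV () ⊗ₜ[k] ·) hc)⟩

theorem exists_basis_vpow (bV : Module.Basis Unit k V) :
    ∃ b : Module.Basis ℕ k (D.tensorAlg V), ∀ n, b n = D.vpow V (bV ()) n := by
  choose c hc using exists_basis_tpow (D := D) bV
  refine ⟨(DFinsupp.basis c).reindex (Equiv.sigmaUnique ℕ fun _ => Unit), fun n => ?_⟩
  rw [Module.Basis.reindex_apply, vpow, ← hc]
  refine Module.Basis.apply_eq_iff.mpr ?_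
  ext ⟨i, j⟩
  change (c i).repr ((DFinsupp.single n (c n ()) : Π₀ m, (D.tpow V m).carrier) i) j =
    Finsupp.single (⟨n, ()⟩ : Σ _ : ℕ, Unit) (1 : k) ⟨i, j⟩
  by_cases h : n = i
  · subst h
    rw [DFinsupp.single_eq_same, Module.Basis.repr_self]
    simp
  · have h' : (⟨i, j⟩ : Σ _ : ℕ, Unit) ≠ ⟨n, ()⟩ := fun e => h (congrArg Sigma.fst e).symm
    rw [DFinsupp.single_eq_of_ne (Ne.symm h), (c i).repr.map_zero, Finsupp.single_eq_of_ne h']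
    rfl

end TensorAlgebra

section ChiPow

variable {k : Type u} {H : Type v} [Field k] [AddCommGroup H] [Module k H] [Coalgebra k H]

theorem chiPow_eq_prod (D : DualQuasiBialgebra k H) (g : H) (χ : H →ₗ[k] k) (n : ℕ) :
    D.chiPow g χ n =
      ((List.range n).map fun i => slot₁ D.ω.val g (D.pow g (n - 1 - i)) * WithConv.toConv χ *
        slot₂ (D.ω⁻¹).val g (D.pow g (n - 1 - i))).prod *
      ((List.range n).map fun i => slot₃ D.ω.val g (D.pow g i)).prod := by
  induction n with
  | zero => simp [chiPow, toConv_counit]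
  | succ n ih =>
    rw [chiPow, ih, List.prod_range_succ', List.prod_range_succ]
    have e (i : ℕ) : n - 1 - i = n - i.succ := by omega
    simp only [mul_assoc, Nat.add_sub_cancel, Nat.sub_zero, e]

end ChiPow

theorem YDDatum.mu_eq_prod {k : Type u} {H : Type v} [Field k] [AddCommGroup H] [Module k H]
    [Coalgebra k H] {D : DualQuasiBialgebra k H} (d : YDDatum D) (a b : ℕ) :
    d.mu a b = ∏ i ∈ Finset.range a, D.omInv d.g (D.pow d.g i) (D.pow d.g b) := by
  refine Finset.prod_congr rfl fun i _ => ?_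
  rw [← d.pow_g, ← d.pow_g, D.omInv_eq_inv d.grouplike (d ^ i).grouplike (d ^ b).grouplike]

end DualQuasiBialgebra

open DualQuasiBialgebra in
theorem mainTheorem3 {k : Type u} {H : Type v} [Field k] [AddCommGroup H] [Module k H]
    [Coalgebra k H] (D : DualQuasiBialgebra k H) (g : H) (χ : H →ₗ[k] k)
    (hD : IsQuasiYDDatum D g χ) (q : k) (hq : q = χ g)
    (V : Type u) [AddCommGroup V] [Module k V] (hV : Module.finrank k V = 1)
    (x : V) (hx : x ≠ 0) :
    -- `V` is a Yetter-Drinfeld module and `T(V)` is the free algebra on it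
    D.IsYetterDrinfeld (ActCoact.ofDatum g χ V) ∧
    D.IsFreeAlgebra (ActCoact.ofDatum g χ V) ∧
    -- the elements `v^[n]` form a basis
    (∃ b : Module.Basis ℕ k (D.tensorAlg (ActCoact.ofDatum g χ V)),
      ∀ n, b n = D.vpow (ActCoact.ofDatum g χ V) x n) ∧
    -- the coaction and the action
    (∀ n, (D.tensorAlg (ActCoact.ofDatum g χ V)).coact (D.vpow (ActCoact.ofDatum g χ V) x n) =
      D.pow g n ⊗ₜ[k] D.vpow (ActCoact.ofDatum g χ V) x n) ∧
    (∀ n (h : H), (D.tensorAlg (ActCoact.ofDatum g χ V)).act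
        (h ⊗ₜ[k] D.vpow (ActCoact.ofDatum g χ V) x n) =
      (D.chiPow g χ n).ofConv h • D.vpow (ActCoact.ofDatum g χ V) x n) ∧
    (∀ n, 1 ≤ n → D.chiPow g χ n =
      ((List.range n).map fun i => slot₁ D.ω.val g (D.pow g (n - 1 - i)) * WithConv.toConv χ *
        slot₂ (D.ω⁻¹).val g (D.pow g (n - 1 - i))).prod *
      ((List.range n).map fun i => slot₃ D.ω.val g (D.pow g i)).prod) ∧
    (∀ n, 1 ≤ n → (D.chiPow g χ n).ofConv g =
      q ^ n * ∏ i ∈ Finset.range n, D.om g (D.pow g i) g) ∧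
    -- the algebra structure
    D.tone (ActCoact.ofDatum g χ V) = D.vpow (ActCoact.ofDatum g χ V) x 0 ∧
    (∀ a b, D.tmul (ActCoact.ofDatum g χ V)
        (D.vpow (ActCoact.ofDatum g χ V) x a ⊗ₜ[k] D.vpow (ActCoact.ofDatum g χ V) x b) =
      (∏ i ∈ Finset.range a, D.omInv g (D.pow g i) (D.pow g b)) •
        D.vpow (ActCoact.ofDatum g χ V) x (a + b)) ∧
    -- the coalgebra structure
    (∃ (Δ : D.tensorAlg (ActCoact.ofDatum g χ V) →ₗ[k]
          D.tensorAlg (ActCoact.ofDatum g χ V) ⊗[k] D.tensorAlg (ActCoact.ofDatum g χ V))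
        (ε : D.tensorAlg (ActCoact.ofDatum g χ V) →ₗ[k] k),
      D.IsTensorBialgebra (ActCoact.ofDatum g χ V) Δ ε ∧
      (∀ Δ' ε', D.IsTensorBialgebra (ActCoact.ofDatum g χ V) Δ' ε' → Δ' = Δ ∧ ε' = ε) ∧
      (∀ n, ε (D.vpow (ActCoact.ofDatum g χ V) x n) = if n = 0 then 1 else 0) ∧
      (∀ n, Δ (D.vpow (ActCoact.ofDatum g χ V) x n) =
        ∑ i ∈ Finset.range (n + 1), D.beta g q i n •
          (D.vpow (ActCoact.ofDatum g χ V) x i ⊗ₜ[k]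
            D.vpow (ActCoact.ofDatum g χ V) x (n - i)))) ∧
    (∀ n, D.beta g q 0 n = 1 ∧ D.beta g q n n = 1) := by
  subst hq
  let d : YDDatum D := ⟨g, χ, hD⟩
  let W := ActCoact.ofDatum g χ V
  let bV : Module.Basis Unit k W := FiniteDimensional.basisSingleton Unit hV x hx
  have hbV : bV () = x := FiniteDimensional.basisSingleton_apply Unit hV x hx ()
  have hW (y : W) : IsHomog W d y := isHomog_ofDatum d V y
  obtain ⟨b, hb⟩ := exists_basis_vpow (D := D) bV
  rw [hbV] at hb
  have hbh (n : ℕ) : IsHomog (D.tensorAlg W) (d ^ n) (b n) := by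
    rw [hb]; exact isHomog_vpow (hW x) n
  have hbm (i j : ℕ) : D.tmul W (b i ⊗ₜ[k] b j) = d.mu i j • b (i + j) := by
    simp only [hb]; exact tmul_vpow (hW x) i j
  have hb₀ : b 0 = D.tone W := hb 0
  have hb₁ : b 1 = D.incl W 1 x := hb 1
  have hV_ext {M : Type _} [AddCommGroup M] [Module k M] {f f' : W →ₗ[k] M} (h : f x = f' x)
      (y : W) : f y = f' y :=
    LinearMap.congr_fun (bV.ext fun _ => by rw [hbV]; exact h) y
  have hbeta (i j : ℕ) : D.beta g (χ g) i (i + j) = qBinom (χ g) (i + j) i / d.mu i j :=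
    d.beta_eq (χ g) i j
  have hΔ (n : ℕ) : gaussComul d b (b n) = ∑ i ∈ Finset.range (n + 1),
      D.beta g (χ g) i n • (b i ⊗ₜ[k] b (n - i)) := by
    rw [gaussComul_basis]
    refine (Finset.Nat.sum_antidiagonal_eq_sum_range_succ
      (fun i j => (qBinom (χ g) n i / d.mu i j) • (b i ⊗ₜ[k] b j)) n).trans ?_
    refine Finset.sum_congr rfl fun i hi => ?_
    obtain ⟨j, rfl⟩ := Nat.exists_eq_add_of_le (Nat.lt_succ_iff.mp (Finset.mem_range.mp hi))
    rw [hbeta, Nat.add_sub_cancel_left]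
  have hbi := isBialgebra_of_basis hbh hbm
  refine ⟨?_, ⟨?_, isHom_incl 1, ?_⟩, ⟨b, hb⟩, ?_, ?_, fun n _ => D.chiPow_eq_prod g χ n, ?_, rfl,
    ?_, ⟨gaussComul d b, gradedCounit b, ⟨?_, ?_, ?_⟩, ?_, ?_, ?_⟩, ?_⟩
  · refine SpannedByHomog.isYetterDrinfeld (D := D) (top_unique ?_)
    exact fun y _ => Submodule.subset_span ⟨d, hW y⟩
  · rw [← hb₀]; exact isAlgebra_of_basis hbh hbm
  · intro A m e hA f hf
    have h := exists_unique_lift_of_basis hbh hbm hA ((hW x).map hf)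
    refine (existsUnique_congr fun F => ?_).mp h
    rw [hb₀, hb₁]
    refine and_congr_right fun _ => and_congr_right fun _ => and_congr_right fun _ => ?_
    exact ⟨fun h => hV_ext (f := F ∘ₗ D.incl W 1) h, fun h => h x⟩
  · intro n
    have := (hbh n).coact
    rw [hb, d.pow_g] at this
    exact this
  · intro n h
    have := (hbh n).act h
    rw [hb, d.pow_chi] at this
    exact this
  · intro n _
    -- `g = g ^ 1` and `μ(1, n) = 1`, while `μ(n, 1)⁻¹` is the product of values of `ω`
    have h := d.chi_pow n 1
    rw [pow_one, d.pow_chi, one_mul, d.mu_one_left, mul_one, div_eq_mul_inv, YDDatum.mu,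
      Finset.prod_inv_distrib, inv_inv, pow_one] at h
    simp only [d.pow_g] at h
    exact h
  · intro i j
    have := hbm i j
    rw [hb, hb, hb, d.mu_eq_prod] at this
    exact this
  · rw [← hb₀]; exact hbi
  · have h : gaussComul d b (D.incl W 1 x) =
        D.incl W 1 x ⊗ₜ[k] D.tone W + D.tone W ⊗ₜ[k] D.incl W 1 x := by
      rw [← hb₀, ← hb₁]; exact gaussComul_basis_one
    exact hV_ext (f := gaussComul d b ∘ₗ D.incl W 1)
      (f' := (TensorProduct.mk k _ _).flip (D.tone W) ∘ₗ D.incl W 1 +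
        TensorProduct.mk k _ _ (D.tone W) ∘ₗ D.incl W 1) h
  · have h : gradedCounit b (D.incl W 1 x) = 0 := by
      rw [← hb₁, gradedCounit_basis]; rfl
    exact hV_ext (f := gradedCounit b ∘ₗ D.incl W 1) (f' := 0) h
  · intro Δ' ε' h
    have hB := h.isBialgebra
    rw [show D.tone (ActCoact.ofDatum g χ V) = b 0 from hb₀.symm] at hB
    refine isBialgebra_unique hbm hB hbi ?_ ?_
    · rw [gaussComul_basis_one, hb₀, hb₁]; exact h.comul_incl x
    · rw [gradedCounit_basis, hb₁]; exact h.counit_incl x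
  · intro n
    have := gradedCounit_basis b n
    rw [hb] at this
    exact this
  · intro n
    have := hΔ n
    simp only [hb] at this
    exact this
  · intro n
    have h₁ := hbeta 0 n
    have h₂ := hbeta n 0
    rw [zero_add, qBinom_zero_right, d.mu_zero_left, div_one] at h₁
    rw [add_zero, qBinom_self, d.mu_zero_right, div_one] at h₂
    exact ⟨h₁, h₂⟩

end
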